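/- For every constant $C$ there is a constant $C'>0$, depending only on $C$, such that the following holds. Let $\mathcal O\subset\mathbb R^3$ be a bounded open set and let $-\Delta_N$ be its Neumann Laplacian, i.e. the operator on the complex Hilbert space $L^2(\mathcal O)$ associated with the quadratic form $\int_{\mathcal O}|\nabla\psi|^2$ with form domain $H^1(\mathcal O)$. Let $\theta\in C^\infty(\overline{\mathcal O})$ be real-valued (smooth in $\mathcal O$, with $\theta$ and all its derivatives extending continuously to $\overline{\mathcal O}$), with $\operatorname{supp}|\nabla\theta|\subset\mathcal O$, and suppose that for some $t>0$ and all $i,j,k\in\{1,2,3\}$ $$\|\partial_i\theta\|_\infty\le Ct^{-1},\qquad \|\partial_i\partial_j\theta\|_\infty\le Ct^{-2},\qquad \|\partial_i\partial_j\partial_k\theta\|_\infty\le Ct^{-3}$$ (supremum norms over $\mathcal O$). Then for all $s>0$ the following two statements hold, where $\theta$ also denotes the operator of multiplication by $\theta$. (1) The double commutator $\left[\left[\frac{(-\Delta_N)^2}{-\Delta_N+s^{-2}},\theta\right],\theta\right]$ is defined exactly on the domain of $-\Delta_N$, and there the operator inequality $$\left[\left[\frac{(-\Delta_N)^2}{-\Delta_N+s^{-2}},\theta\right],\theta\right]\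 \ge\ -C't^{-2}\,\frac{-\Delta_N}{-\Delta_N+s^{-2}}-C's^2t^{-4}$$ holds. (2) The double commutator $\left[\left[\frac{-\Delta_N}{-\Delta_N+s^{-2}},\theta\right],\theta\right]$ is defined on all of $L^2(\mathcal O)$, and $$\left\|\left[\left[\frac{-\Delta_N}{-\Delta_N+s^{-2}},\theta\right],\theta\right]\right\|\ \le\ C'\left(s^2t^{-2}+s^4t^{-4}\right).$$ -/

import Mathlib

open MeasureTheory
open scoped ContDiff

namespace DoubleCommutator

noncomputable section

/-- Euclidean three-space. -/
abbrev E3 : Type := EuclideanSpace ℝ (Fin 3)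

/-- The complex Hilbert space `L²(O)`, with Lebesgue measure on `O`. -/
abbrev L2 (O : Set E3) : Type := Lp ℂ 2 (volume.restrict O)

/-- The partial derivative `∂ᵢ f`. -/
def pderiv (i : Fin 3) (f : E3 → ℝ) (x : E3) : ℝ :=
  fderiv ℝ f x (EuclideanSpace.single i 1)

/-! ### The Neumann Laplacian -/

/-- `φ` is a (real) test function on `O`, i.e. an element of `C_c^∞(O)`. -/
structure IsTest (O : Set E3) (φ : E3 → ℝ) : Prop where
  smooth : ContDiff ℝ ∞ φ
  compact : HasCompactSupport φ
  support : tsupport φ ⊆ O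

/-- `g ∈ L²(O)` is the weak partial derivative `∂ᵢ u` of `u ∈ L²(O)`:
`∫_O (∂ᵢ φ) u = - ∫_O φ g` for all test functions `φ` on `O`. -/
def IsWeakPartial (O : Set E3) (i : Fin 3) (u g : L2 O) : Prop :=
  ∀ φ : E3 → ℝ, IsTest O φ →
    ∫ x in O, pderiv i φ x • u x = - ∫ x in O, φ x • g x

/-- `u` lies in the Sobolev space `H¹(O)` and `p` is its weak gradient. -/
def IsWeakGrad (O : Set E3) (u : L2 O) (p : Fin 3 → L2 O) : Prop :=
  ∀ i, IsWeakPartial O i u (p i)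

theorem IsTest.pderiv_continuous {O : Set E3} {φ : E3 → ℝ} (h : IsTest O φ) (i : Fin 3) :
    Continuous (pderiv i φ) :=
  (h.smooth.continuous_fderiv (by simp)).clm_apply continuous_const

theorem IsTest.pderiv_compact {O : Set E3} {φ : E3 → ℝ} (h : IsTest O φ) (i : Fin 3) :
    HasCompactSupport (pderiv i φ) :=
  h.compact.fderiv_apply ℝ (EuclideanSpace.single i 1)

theorem integrable_smul {O : Set E3} {ψ : E3 → ℝ} (hc : Continuous ψ)
    (hs : HasCompactSupport ψ) (u : L2 O) :
    Integrable (fun x => ψ x • u x) (volume.restrict O) :=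
  ((Lp.memLp u).locallyIntegrable (by norm_num)).integrable_smul_left_of_hasCompactSupport hc hs

theorem integral_smul_add {O : Set E3} {ψ : E3 → ℝ} (hc : Continuous ψ)
    (hs : HasCompactSupport ψ) (u v : L2 O) :
    ∫ x in O, ψ x • (u + v : L2 O) x = (∫ x in O, ψ x • u x) + ∫ x in O, ψ x • v x := by
  rw [← integral_add (integrable_smul hc hs u) (integrable_smul hc hs v)]
  refine integral_congr_ae ?_
  filter_upwards [Lp.coeFn_add u v] with x hx
  rw [hx, Pi.add_apply, smul_add]

theorem integral_smul_smul {O : Set E3} (ψ : E3 → ℝ) (c : ℂ) (u : L2 O) :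
    ∫ x in O, ψ x • (c • u : L2 O) x = c * ∫ x in O, ψ x • u x := by
  rw [← integral_const_mul]
  refine integral_congr_ae ?_
  filter_upwards [Lp.coeFn_smul c u] with x hx
  rw [hx, Pi.smul_apply, smul_comm, smul_eq_mul]

theorem IsWeakGrad.add {O : Set E3} {u v : L2 O} {p q : Fin 3 → L2 O}
    (hu : IsWeakGrad O u p) (hv : IsWeakGrad O v q) : IsWeakGrad O (u + v) (p + q) := by
  intro i φ hφ
  rw [Pi.add_apply, integral_smul_add (hφ.pderiv_continuous i) (hφ.pderiv_compact i),
    integral_smul_add hφ.smooth.continuous hφ.compact, hu i φ hφ, hv i φ hφ, neg_add]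

theorem IsWeakGrad.smul {O : Set E3} {u : L2 O} {p : Fin 3 → L2 O} (c : ℂ)
    (hu : IsWeakGrad O u p) : IsWeakGrad O (c • u) (c • p) := by
  intro i φ hφ
  rw [Pi.smul_apply, integral_smul_smul, integral_smul_smul, hu i φ hφ, mul_neg]

theorem IsWeakGrad.zero {O : Set E3} : IsWeakGrad O 0 0 := by
  intro i φ _
  have e : ∀ ψ : E3 → ℝ, ∫ x in O, ψ x • (0 : L2 O) x = 0 := fun ψ => by
    have := integral_smul_smul ψ 0 (0 : L2 O)
    rwa [zero_smul, zero_mul] at this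
  rw [Pi.zero_apply, e, e, neg_zero]

/-- The graph of `-Δ_N`, the operator associated with the quadratic form `∫_O |∇u|²` with form
domain `H¹(O)`: the pair `(u, f)` belongs to it if `u ∈ H¹(O)` and
`∫_O ∇u · conj(∇v) = ∫_O f conj(v)` for all `v ∈ H¹(O)`. -/
def neumannGraph (O : Set E3) : Submodule ℂ (L2 O × L2 O) where
  carrier := {a | ∃ p : Fin 3 → L2 O, IsWeakGrad O a.1 p ∧
    ∀ (v : L2 O) (q : Fin 3 → L2 O), IsWeakGrad O v q →
      ∑ i, inner ℂ (q i) (p i) = inner ℂ v a.2}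
  zero_mem' := ⟨0, IsWeakGrad.zero, fun v q _ => by simp⟩
  add_mem' := by
    rintro a b ⟨p, hp, hp'⟩ ⟨q, hq, hq'⟩
    refine ⟨p + q, hp.add hq, fun v r hr => ?_⟩
    rw [Prod.snd_add, inner_add_right, ← hp' v r hr, ← hq' v r hr, ← Finset.sum_add_distrib]
    exact Finset.sum_congr rfl fun i _ => by rw [Pi.add_apply, inner_add_right]
  smul_mem' := by
    rintro c a ⟨p, hp, hp'⟩
    refine ⟨c • p, hp.smul c, fun v r hr => ?_⟩
    rw [Prod.smul_snd, inner_smul_right, ← hp' v r hr, Finset.mul_sum]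
    exact Finset.sum_congr rfl fun i _ => by rw [Pi.smul_apply, inner_smul_right]

/-- The Neumann Laplacian `-Δ_N` of `O`, as an unbounded operator on `L²(O)`. -/
def negLaplacian (O : Set E3) : L2 O →ₗ.[ℂ] L2 O := (neumannGraph O).toLinearPMap

/-- An element of `L²(O)` that vanishes against all test functions is zero. -/
theorem eq_zero_of_test {O : Set E3} (hO : IsOpen O) (g : L2 O)
    (h : ∀ φ : E3 → ℝ, IsTest O φ → ∫ x in O, φ x • g x = 0) : g = 0 := by
  have hloc : LocallyIntegrableOn g O (volume.restrict O) :=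
    ((Lp.memLp g).locallyIntegrable (by norm_num)).locallyIntegrableOn O
  have h1 := hO.ae_eq_zero_of_integral_contDiff_smul_eq_zero hloc
    fun φ h1 h2 h3 => h φ ⟨h1, h2, h3⟩
  refine (Lp.eq_zero_iff_ae_eq_zero).mpr ?_
  filter_upwards [h1, ae_restrict_mem hO.measurableSet] with x hx hxO
  exact hx hxO

theorem memLp_ofReal {O : Set E3} {ψ : E3 → ℝ} (hc : Continuous ψ)
    (hs : HasCompactSupport ψ) : MemLp (fun x => (ψ x : ℂ)) 2 (volume.restrict O) :=
  (Complex.continuous_ofReal.comp hc).memLp_of_hasCompactSupport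
    (hs.comp_left (g := fun r : ℝ => (r : ℂ)) Complex.ofReal_zero)

/-- A test function lies in `H¹(O)`, with its classical gradient. -/
theorem IsTest.isWeakGrad {O : Set E3} {φ : E3 → ℝ} (hφ : IsTest O φ) :
    IsWeakGrad O ((memLp_ofReal hφ.smooth.continuous hφ.compact).toLp _)
      (fun i => (memLp_ofReal (hφ.pderiv_continuous i) (hφ.pderiv_compact i)).toLp _) := by
  intro i ψ hψ
  have e1 : ∀ {ρ σ : E3 → ℝ} (hσ : MemLp (fun x => (σ x : ℂ)) 2 (volume.restrict O)),
      Function.support ρ ⊆ O →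
      ∫ x in O, ρ x • hσ.toLp _ x = ((∫ x, ρ x * σ x : ℝ) : ℂ) := by
    intro ρ σ hσ hρ
    have h0 : ∫ x in O, ρ x * σ x = ∫ x, ρ x * σ x :=
      setIntegral_eq_integral_of_forall_compl_eq_zero fun x hx => by
        rw [Function.notMem_support.mp fun h => hx (hρ h), zero_mul]
    rw [← h0]
    refine Eq.trans (integral_congr_ae ?_) (integral_ofReal (𝕜 := ℂ))
    filter_upwards [hσ.coeFn_toLp] with x hx
    rw [hx, Complex.real_smul]
    exact (Complex.ofReal_mul _ _).symm
  have hsub : Function.support (pderiv i ψ) ⊆ O := fun x hx => by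
    refine hψ.support (support_fderiv_subset ℝ (f := ψ) fun h => hx ?_)
    simp [pderiv, h]
  rw [e1 _ hsub, e1 _ ((subset_tsupport ψ).trans hψ.support), ← Complex.ofReal_neg]
  congr 1
  have hi : ∀ {f g : E3 → ℝ}, Continuous f → Continuous g → HasCompactSupport g →
      Integrable (fun x => f x * g x) := fun hf hg hs =>
    (hf.mul hg).integrable_of_hasCompactSupport hs.mul_left
  have h := integral_mul_fderiv_eq_neg_fderiv_mul_of_integrable (μ := volume)
    (v := EuclideanSpace.single i (1 : ℝ)) (f := ψ) (g := φ)
    (hi (hψ.pderiv_continuous i) hφ.smooth.continuous hφ.compact)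
    (hi hψ.smooth.continuous (hφ.pderiv_continuous i) (hφ.pderiv_compact i))
    (hi hψ.smooth.continuous hφ.smooth.continuous hφ.compact)
    (fun x _ => hψ.smooth.differentiable (by simp) x)
    (fun x _ => hφ.smooth.differentiable (by simp) x)
  exact (neg_eq_iff_eq_neg.mpr h).symm

/-- On an open set, `neumannGraph` is the graph of an operator. -/
theorem neumannGraph_functional {O : Set E3} (hO : IsOpen O) (a : L2 O × L2 O)
    (ha : a ∈ neumannGraph O) (h0 : a.1 = 0) : a.2 = 0 := by
  obtain ⟨p, hp, hp'⟩ := ha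
  rw [h0] at hp
  have hp0 : ∀ i, p i = 0 := fun i => eq_zero_of_test hO _ fun φ hφ => by
    have h1 := hp i φ hφ
    have h2 := integral_smul_smul (O := O) (pderiv i φ) 0 0
    rw [zero_smul, zero_mul] at h2
    rw [h2] at h1
    exact neg_eq_zero.mp h1.symm
  refine eq_zero_of_test hO _ fun φ hφ => ?_
  have h := hp' _ _ hφ.isWeakGrad
  simp only [hp0, inner_zero_right, Finset.sum_const_zero] at h
  rw [h, L2.inner_def]
  refine integral_congr_ae ?_
  filter_upwards [(memLp_ofReal (O := O) hφ.smooth.continuous hφ.compact).coeFn_toLp] with x hx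
  rw [hx, Complex.real_smul, RCLike.inner_apply, Complex.conj_ofReal, mul_comm]

theorem negLaplacian_graph {O : Set E3} (hO : IsOpen O) :
    (negLaplacian O).graph = neumannGraph O :=
  Submodule.toLinearPMap_graph_eq _ (neumannGraph_functional hO)

/-! ### Algebra of unbounded operators, all with their natural domains -/

/-- The product `g f` of unbounded operators, with domain `{x ∈ D(f) | f x ∈ D(g)}`. -/
def opMul {H : Type*} [NormedAddCommGroup H] [InnerProductSpace ℂ H]
    (g f : H →ₗ.[ℂ] H) : H →ₗ.[ℂ] H where
  domain :=
    { carrier := {x | ∃ h : x ∈ f.domain, f ⟨x, h⟩ ∈ g.domain}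
      zero_mem' := ⟨f.domain.zero_mem, by
        have : f ⟨0, f.domain.zero_mem⟩ = 0 := f.map_zero
        rw [this]; exact g.domain.zero_mem⟩
      add_mem' := by
        rintro x y ⟨hx, hx'⟩ ⟨hy, hy'⟩
        refine ⟨f.domain.add_mem hx hy, ?_⟩
        have : f ⟨x + y, f.domain.add_mem hx hy⟩ = f ⟨x, hx⟩ + f ⟨y, hy⟩ :=
          f.map_add ⟨x, hx⟩ ⟨y, hy⟩
        rw [this]; exact g.domain.add_mem hx' hy'
      smul_mem' := by
        rintro c x ⟨hx, hx'⟩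
        refine ⟨f.domain.smul_mem c hx, ?_⟩
        have : f ⟨c • x, f.domain.smul_mem c hx⟩ = c • f ⟨x, hx⟩ := f.map_smul c ⟨x, hx⟩
        rw [this]; exact g.domain.smul_mem c hx' }
  toFun :=
    { toFun := fun x => g ⟨f ⟨x.1, x.2.1⟩, x.2.2⟩
      map_add' := fun x y => by
        rw [← g.map_add]
        exact congrArg g (Subtype.ext (f.map_add ⟨x.1, x.2.1⟩ ⟨y.1, y.2.1⟩))
      map_smul' := fun c x => by
        rw [RingHom.id_apply, ← g.map_smul]
        exact congrArg g (Subtype.ext (f.map_smul c ⟨x.1, x.2.1⟩)) }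

/-- The commutator `[S, T] = S T - T S`. -/
def opComm {H : Type*} [NormedAddCommGroup H] [InnerProductSpace ℂ H]
    (S T : H →ₗ.[ℂ] H) : H →ₗ.[ℂ] H := opMul S T - opMul T S

/-- The everywhere defined operator of multiplication by the real number `c`. -/
def opScalar {H : Type*} [NormedAddCommGroup H] [InnerProductSpace ℂ H]
    (c : ℝ) : H →ₗ.[ℂ] H := ((c : ℂ) • LinearMap.id).toPMap ⊤

/-- The operator inequality `S ≤ T` on the domain of `T`: `S` is defined there, and
`⟨u, (T - S) u⟩` is real and nonnegative for every `u ∈ D(T)`. -/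
def OpLE {H : Type*} [NormedAddCommGroup H] [InnerProductSpace ℂ H]
    (S T : H →ₗ.[ℂ] H) : Prop :=
  ∃ h : T.domain ≤ S.domain, ∀ u : T.domain,
    (inner ℂ (u : H) (T u - S ⟨u, h u.2⟩)).im = 0 ∧
    0 ≤ (inner ℂ (u : H) (T u - S ⟨u, h u.2⟩)).re

/-- The resolvent `(A + c)⁻¹`. -/
def resolventInv {H : Type*} [NormedAddCommGroup H] [InnerProductSpace ℂ H]
    (A : H →ₗ.[ℂ] H) (c : ℝ) : H →ₗ.[ℂ] H := (A + opScalar c).inverse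

/-- `A / (A + c)`. -/
def opFrac {H : Type*} [NormedAddCommGroup H] [InnerProductSpace ℂ H]
    (A : H →ₗ.[ℂ] H) (c : ℝ) : H →ₗ.[ℂ] H := opMul A (resolventInv A c)

/-- `A² / (A + c)`. -/
def opSqFrac {H : Type*} [NormedAddCommGroup H] [InnerProductSpace ℂ H]
    (A : H →ₗ.[ℂ] H) (c : ℝ) : H →ₗ.[ℂ] H := opMul (opMul A A) (resolventInv A c)

/-- For `c > 0`, the operator `-Δ_N + c` is injective, so that its inverse is meaningful. -/
theorem negLaplacian_add_ker {O : Set E3} (hO : IsOpen O) {c : ℝ} (hc : 0 < c) :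
    (negLaplacian O + opScalar c).toFun.ker = ⊥ := by
  refine LinearMap.ker_eq_bot'.mpr fun u hu => ?_
  have hsum : negLaplacian O ⟨u.1, u.2.1⟩ + (c : ℂ) • (u : L2 O) = 0 := hu
  have hg := (negLaplacian O).mem_graph ⟨u.1, u.2.1⟩
  rw [negLaplacian_graph hO] at hg
  obtain ⟨p, hp, hp'⟩ := hg
  have h := hp' _ _ hp
  simp only [] at h
  rw [eq_neg_of_add_eq_zero_left hsum, inner_neg_right, inner_smul_right] at h
  have hre := congrArg Complex.re h
  have hn : ∀ w : L2 O, (inner ℂ w w).re = ‖w‖ ^ 2 := fun w => inner_self_eq_norm_sq (𝕜 := ℂ) w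
  rw [Complex.re_sum, Complex.neg_re, Complex.re_ofReal_mul] at hre
  simp only [hn] at hre
  have h1 : 0 ≤ ∑ i, ‖p i‖ ^ 2 := Finset.sum_nonneg fun i _ => by positivity
  have h2 : ‖(u : L2 O)‖ ^ 2 ≤ 0 := by
    by_contra! hlt
    have := mul_pos hc hlt
    linarith
  have h3 : ‖(u : L2 O)‖ = 0 := by nlinarith [norm_nonneg (u : L2 O)]
  exact Subtype.ext (norm_eq_zero.mp h3)

/-! ### Multiplication operators and the class of functions `θ` -/

theorem mul_add_ae {O : Set E3} (θ : E3 → ℝ) (u v : L2 O) :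
    (fun x => (θ x : ℂ) * (u + v : L2 O) x) =ᵐ[volume.restrict O]
      (fun x => (θ x : ℂ) * u x) + fun x => (θ x : ℂ) * v x := by
  filter_upwards [Lp.coeFn_add u v] with x hx
  rw [hx, Pi.add_apply, Pi.add_apply, mul_add]

theorem mul_smul_ae {O : Set E3} (θ : E3 → ℝ) (c : ℂ) (u : L2 O) :
    (fun x => (θ x : ℂ) * (c • u : L2 O) x) =ᵐ[volume.restrict O]
      c • fun x => (θ x : ℂ) * u x := by
  filter_upwards [Lp.coeFn_smul c u] with x hx
  rw [hx, Pi.smul_apply, Pi.smul_apply, smul_eq_mul, smul_eq_mul, mul_left_comm]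

theorem mul_memLp_zero {O : Set E3} (θ : E3 → ℝ) :
    MemLp (fun x => (θ x : ℂ) * (0 : L2 O) x) 2 (volume.restrict O) := by
  refine (MemLp.zero (p := 2) (ε := ℂ) (μ := volume.restrict O)).ae_eq ?_
  filter_upwards [Lp.coeFn_zero ℂ 2 (volume.restrict O)] with x hx
  rw [hx, Pi.zero_apply, mul_zero]

/-- The maximal domain `{u ∈ L²(O) | θ u ∈ L²(O)}` of multiplication by the function `θ`. -/
def mulDomain (O : Set E3) (θ : E3 → ℝ) : Submodule ℂ (L2 O) where
  carrier := {u | MemLp (fun x => (θ x : ℂ) * u x) 2 (volume.restrict O)}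
  zero_mem' := mul_memLp_zero θ
  add_mem' := fun {u v} hu hv => (memLp_congr_ae (mul_add_ae θ u v)).mpr (MemLp.add hu hv)
  smul_mem' := fun c u hu => (memLp_congr_ae (mul_smul_ae θ c u)).mpr (MemLp.const_smul hu c)

theorem mem_mulDomain {O : Set E3} {θ : E3 → ℝ} (u : mulDomain O θ) :
    MemLp (fun x => (θ x : ℂ) * (u : L2 O) x) 2 (volume.restrict O) := u.2

/-- The operator of multiplication by the function `θ` on `L²(O)`, on its maximal domain. -/
def mulOp (O : Set E3) (θ : E3 → ℝ) : L2 O →ₗ.[ℂ] L2 O where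
  domain := mulDomain O θ
  toFun :=
    { toFun := fun u => (mem_mulDomain u).toLp _
      map_add' := fun u v => by
        rw [← MemLp.toLp_add (mem_mulDomain u) (mem_mulDomain v)]
        exact MemLp.toLp_congr _ _ (mul_add_ae θ u.1 v.1)
      map_smul' := fun c u => by
        rw [RingHom.id_apply, ← MemLp.toLp_const_smul c (mem_mulDomain u)]
        exact MemLp.toLp_congr _ _ (mul_smul_ae θ c u.1) }

/-- `θ ∈ C^∞(closure O)`: `θ` is smooth in `O`, and all its derivatives (including `θ` itself)
extend continuously to the closure of `O`. -/
def SmoothUpToBoundary (O : Set E3) (θ : E3 → ℝ) : Prop :=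
  ContDiffOn ℝ ∞ θ O ∧
  ∀ k : ℕ, ∃ g : E3 → ContinuousMultilinearMap ℝ (fun _ : Fin k => E3) ℝ,
    ContinuousOn g (closure O) ∧ Set.EqOn g (iteratedFDeriv ℝ k θ) O

/-- `supp |∇θ| ⊆ O`, where the support is the closure in `ℝ³` of `{x ∈ O | ∇θ(x) ≠ 0}`. -/
def GradSupportedIn (O : Set E3) (θ : E3 → ℝ) : Prop :=
  closure {x | x ∈ O ∧ fderiv ℝ θ x ≠ 0} ⊆ O

/-- The bounds `‖∂ᵢθ‖ ≤ C t⁻¹`, `‖∂ᵢ∂ⱼθ‖ ≤ C t⁻²`, `‖∂ᵢ∂ⱼ∂ₖθ‖ ≤ C t⁻³` in supremum norm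
over `O`. -/
def DerivBounds (O : Set E3) (θ : E3 → ℝ) (C t : ℝ) : Prop :=
  ∀ x ∈ O, ∀ i j k : Fin 3,
    |pderiv i θ x| ≤ C * t⁻¹ ∧
    |pderiv i (pderiv j θ) x| ≤ C * (t ^ 2)⁻¹ ∧
    |pderiv i (pderiv j (pderiv k θ)) x| ≤ C * (t ^ 3)⁻¹

end

end DoubleCommutator

open DoubleCommutator

/-! Write `A` for the Neumann Laplacian, `c = s⁻²`, `R = (A + c)⁻¹`, `T` for multiplication by `θ`,
`G` for multiplication by `|∇θ|²`, and `L = [A, T] R`. Since `A² / (A + c) = A - c + c² R` and `A /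
(A + c) = 1 - c R`, and scalars commute with `T`, both double commutators reduce to `[[A, T], T] =
-2 G` and to `[[R, T], T]`. The identity `[R, T] = -R [A, T] R` gives `[[R, T], T] = 2 R (G R + L²)`
(`double_comm_R`).

With `α` of order `t⁻²` and `β` of order `t⁻⁴`, the inputs are `‖G‖ ≤ α`, `‖[A, T] x‖² ≤ α ⟨x, A x⟩
+ β ‖x‖²` and `Re ⟨A x, G x⟩ ≤ α ⟨x, A x⟩ + β ‖x‖²`. Together with `c ‖R‖ ≤ 1` they give `‖L‖² ≤ α /
c + β / c²`, and the norm bound (2) follows.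

For (1) the term `-2 G` alone is too large: `α ‖x‖²` is not controlled by the right-hand side at low
energy. Splitting `x = a + c R x` with `a = A R x`, the part `-2 c² ⟨R x, G R x⟩` of `-2 ⟨x, G x⟩`
cancels exactly against `2 c² R G R`. What remains contains `a`, or `L x` on both sides of `R`, and
is bounded by `α ⟨x, a⟩ + (β / c) ‖x‖²` up to a constant (`inner_double_comm`,
`le_re_inner_double_comm`).

The analytic point is that `θ` preserves the Neumann domain and that `[A, T]` is the first-order
operator `-(2 ∇θ · ∇ + Δθ)`. As `∇θ` is compactly supported in `O`, the integration by parts behind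
this has no boundary term. It is carried out between two merely weakly differentiable functions in
`integral_mul_weakDeriv`. -/

namespace DoubleCommutator

/-! ### Double commutators with a resolvent, abstractly -/

section Abstract

variable {H : Type*} [NormedAddCommGroup H] [InnerProductSpace ℂ H]

/-- A nonnegative symmetric operator `A` with resolvent `R = (A + c)⁻¹`, together with a bounded
symmetric operator `T` preserving the domain of `A`, such that `[[A, T], T] = -2 G` with `G`
bounded by `α`, and such that `[A, T]` and `A G` are form bounded with constants `α`, `β`. -/
structure CommutatorData (A : H →ₗ.[ℂ] H) (R T G : H →ₗ[ℂ] H) (c α β : ℝ) : Prop where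
  c_pos : 0 < c
  α_nonneg : 0 ≤ α
  β_nonneg : 0 ≤ β
  symm : ∀ x y : A.domain, inner ℂ (A x) (y : H) = inner ℂ (x : H) (A y)
  nonneg : ∀ x : A.domain, 0 ≤ (inner ℂ (x : H) (A x)).re
  R_mem : ∀ x, R x ∈ A.domain
  A_R : ∀ x, A ⟨R x, R_mem x⟩ = x - (c : ℂ) • R x
  R_A : ∀ x : A.domain, R (A x + (c : ℂ) • (x : H)) = x
  T_symm : ∀ x y, inner ℂ (T x) y = inner ℂ x (T y)
  T_mem : ∀ x : A.domain, T x ∈ A.domain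
  G_symm : ∀ x y, inner ℂ (G x) y = inner ℂ x (G y)
  G_le : ∀ x, ‖G x‖ ≤ α * ‖x‖
  double_comm : ∀ x : A.domain,
    A ⟨T (T x), T_mem ⟨_, T_mem x⟩⟩ - (2 : ℂ) • T (A ⟨T x, T_mem x⟩) + T (T (A x))
      = -(2 : ℂ) • G x
  comm_le : ∀ x : A.domain, ‖A ⟨T x, T_mem x⟩ - T (A x)‖ ^ 2
    ≤ α * (inner ℂ (x : H) (A x)).re + β * ‖(x : H)‖ ^ 2
  form_le : ∀ x : A.domain, (inner ℂ (A x) (G x)).re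
    ≤ α * (inner ℂ (x : H) (A x)).re + β * ‖(x : H)‖ ^ 2

namespace CommutatorData

variable {A : H →ₗ.[ℂ] H} {R T G : H →ₗ[ℂ] H} {c α β : ℝ}

/-- The bounded operator `[A, T] R`. -/
noncomputable def commR (h : CommutatorData A R T G c α β) : H →ₗ[ℂ] H where
  toFun x := A ⟨T (R x), h.T_mem ⟨_, h.R_mem x⟩⟩ - T (x - (c : ℂ) • R x)
  map_add' x y := by
    have : A ⟨T (R (x + y)), h.T_mem ⟨_, h.R_mem (x + y)⟩⟩
        = A ⟨T (R x), h.T_mem ⟨_, h.R_mem x⟩⟩ + A ⟨T (R y), h.T_mem ⟨_, h.R_mem y⟩⟩ := by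
      rw [← A.map_add]
      congr 1
      ext
      simp
    rw [this]
    simp only [map_add, map_sub, map_smul, smul_add]
    abel
  map_smul' a x := by
    have : A ⟨T (R (a • x)), h.T_mem ⟨_, h.R_mem (a • x)⟩⟩
        = a • A ⟨T (R x), h.T_mem ⟨_, h.R_mem x⟩⟩ := by
      rw [← A.map_smul]
      congr 1
      ext
      simp
    rw [this]
    simp only [map_sub, map_smul, smul_sub, RingHom.id_apply, smul_comm a]

variable (h : CommutatorData A R T G c α β)
include h

theorem A_T_R (x : H) : A ⟨T (R x), h.T_mem ⟨_, h.R_mem x⟩⟩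
    = h.commR x + T x - (c : ℂ) • T (R x) := by
  simp only [commR, LinearMap.coe_mk, AddHom.coe_mk, map_sub, map_smul]
  abel

/-- This is `[R, T] = -R [A, T] R`, obtained by applying `R` to `(A + c) T R x = [A, T] R x + T x`.
-/
theorem R_T (x : H) : R (T x) = T (R x) - R (h.commR x) := by
  have := h.R_A ⟨T (R x), h.T_mem ⟨_, h.R_mem x⟩⟩
  rw [h.A_T_R, sub_add_cancel, map_add] at this
  exact eq_sub_of_add_eq' this

theorem R_symm (x y : H) : inner ℂ (R x) y = inner ℂ x (R y) := by
  have := h.symm ⟨R x, h.R_mem x⟩ ⟨R y, h.R_mem y⟩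
  simp only [h.A_R, inner_sub_left, inner_sub_right, inner_smul_left, inner_smul_right,
    Complex.conj_ofReal] at this
  exact (sub_left_inj.mp this).symm

/-- `R [A, T] R` is antisymmetric, because the commutator of two symmetric operators is. The lemma
is what moves one factor `[A, T] R` to the other side of an inner product. -/
theorem inner_R_commR (x y : H) : inner ℂ (R x) (h.commR y) = -inner ℂ (h.commR x) (R y) := by
  have h1 := h.symm ⟨R x, h.R_mem x⟩ ⟨T (R y), h.T_mem ⟨_, h.R_mem y⟩⟩
  have h2 := h.symm ⟨T (R x), h.T_mem ⟨_, h.R_mem x⟩⟩ ⟨R y, h.R_mem y⟩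
  simp only [h.A_R, h.A_T_R, inner_sub_left, inner_sub_right, inner_smul_left, inner_smul_right,
    Complex.conj_ofReal, inner_add_left, inner_add_right, h.T_symm, h.R_symm, map_add, map_sub,
    map_smul] at h1 h2 ⊢
  linear_combination h2 - h1

/-- This is `[[A, T], T] R = -2 G R` with `[A, T]` eliminated: since `T R = R (T + L)` for `L = [A,
T] R`, one has `[A, T] T R = L (T + L)`. -/
theorem commR_T (x : H) :
    h.commR (T x) + h.commR (h.commR x) - T (h.commR x) = -(2 : ℂ) • G (R x) := by
  have hR : T (R x) = R (T x + h.commR x) := by rw [map_add, h.R_T]; abel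
  have h1 := h.double_comm ⟨R x, h.R_mem x⟩
  have h2 : A ⟨T (T (R x)), h.T_mem ⟨_, h.T_mem ⟨_, h.R_mem x⟩⟩⟩
      = A ⟨T (R (T x + h.commR x)), h.T_mem ⟨_, h.R_mem _⟩⟩ := by
    congr 1; ext; simp only [hR]
  simp only [h2, h.A_T_R, h.A_R] at h1
  rw [← h1]
  simp only [map_add, map_sub, map_smul, h.R_T]
  module

/-- With `L = [A, T] R`, repeated use of `R_T` turns the left side into `R (T L - L T) + R L²`, and
`commR_T` gives `T L - L T = 2 G R + L²`. -/
theorem double_comm_R (x : H) : R (T (T x)) - (2 : ℂ) • T (R (T x)) + T (T (R x))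
    = (2 : ℂ) • R (G (R x) + h.commR (h.commR x)) := by
  have h1 : T (R (h.commR x)) = R (T (h.commR x)) + R (h.commR (h.commR x)) := by
    rw [h.R_T (h.commR x)]; abel
  have h2 := congrArg R (h.commR_T x)
  simp only [map_add, map_sub, map_smul] at h2
  rw [h.R_T (T x), h.R_T x]
  simp only [map_sub, map_add]
  rw [h1]
  rw [smul_add, ← sub_eq_zero] at *
  rw [← neg_eq_zero, ← h2]
  module

/-- Both terms on the right are nonnegative, so Cauchy–Schwarz on the left yields the two resolvent
bounds that follow. -/
theorem re_inner_R (x : H) : (inner ℂ (R x) x).re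
    = (inner ℂ (R x) (A ⟨R x, h.R_mem x⟩)).re + c * ‖R x‖ ^ 2 := by
  have h1 : (inner ℂ (R x) (R x)).re = ‖R x‖ ^ 2 := inner_self_eq_norm_sq (𝕜 := ℂ) _
  rw [h.A_R, inner_sub_right, inner_smul_right, Complex.sub_re, Complex.re_ofReal_mul, h1]
  ring

theorem c_mul_norm_R_le (x : H) : c * ‖R x‖ ≤ ‖x‖ := by
  have h1 : 0 ≤ (inner ℂ (R x) (A ⟨R x, h.R_mem x⟩)).re := h.nonneg ⟨R x, h.R_mem x⟩
  have h2 : (inner ℂ (R x) x).re ≤ ‖R x‖ * ‖x‖ := re_inner_le_norm (𝕜 := ℂ) _ _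
  have h3 := h.re_inner_R x
  rcases (norm_nonneg (R x)).eq_or_lt with h0 | h0
  · rw [← h0]; simp
  · refine le_of_mul_le_mul_left ?_ h0
    nlinarith

theorem c_mul_inner_A_R_le (x : H) :
    c * (inner ℂ (R x) (A ⟨R x, h.R_mem x⟩)).re ≤ ‖x‖ ^ 2 := by
  have h2 : (inner ℂ (R x) x).re ≤ ‖R x‖ * ‖x‖ := re_inner_le_norm (𝕜 := ℂ) _ _
  have h3 := h.re_inner_R x
  have h4 := h.c_mul_norm_R_le x
  have h5 := h.c_pos
  have h6 : 0 ≤ c * (c * ‖R x‖ ^ 2) := by positivity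
  nlinarith [norm_nonneg x, norm_nonneg (R x)]

theorem norm_commR_sq_le' (x : H) : ‖h.commR x‖ ^ 2
    ≤ α * (inner ℂ (R x) (A ⟨R x, h.R_mem x⟩)).re + β * ‖R x‖ ^ 2 := by
  have := h.comm_le ⟨R x, h.R_mem x⟩
  rw [h.A_R] at this ⊢
  exact this

theorem norm_commR_sq_le (x : H) : ‖h.commR x‖ ^ 2 ≤ (α * c⁻¹ + β * c⁻¹ ^ 2) * ‖x‖ ^ 2 := by
  have hc := h.c_pos
  refine (h.norm_commR_sq_le' x).trans ?_
  have h1 : (inner ℂ (R x) (A ⟨R x, h.R_mem x⟩)).re ≤ c⁻¹ * ‖x‖ ^ 2 := by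
    rw [inv_mul_eq_div, le_div_iff₀ hc, mul_comm]
    exact h.c_mul_inner_A_R_le x
  have h2 : ‖R x‖ ≤ c⁻¹ * ‖x‖ := by
    rw [inv_mul_eq_div, le_div_iff₀ hc, mul_comm]
    exact h.c_mul_norm_R_le x
  calc _ ≤ α * (c⁻¹ * ‖x‖ ^ 2) + β * (c⁻¹ * ‖x‖) ^ 2 := by
        have := h.α_nonneg
        have := h.β_nonneg
        gcongr
    _ = _ := by ring

/-- The bound on the double commutator of the resolvent. -/
theorem norm_double_comm_R_le (x : H) :
    c * ‖R (T (T x)) - (2 : ℂ) • T (R (T x)) + T (T (R x))‖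
      ≤ 4 * (α * c⁻¹ + β * c⁻¹ ^ 2) * ‖x‖ := by
  have hc := h.c_pos
  have hα := h.α_nonneg
  have hβ := h.β_nonneg
  set κ := α * c⁻¹ + β * c⁻¹ ^ 2 with hκ
  have hκ0 : 0 ≤ κ := by positivity
  have h1 : c * ‖R (G (R x))‖ ≤ κ * ‖x‖ := by
    refine (h.c_mul_norm_R_le _).trans ((h.G_le _).trans ?_)
    have h2 : ‖R x‖ ≤ c⁻¹ * ‖x‖ := by
      rw [inv_mul_eq_div, le_div_iff₀ hc, mul_comm]
      exact h.c_mul_norm_R_le x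
    calc _ ≤ α * (c⁻¹ * ‖x‖) := by gcongr
      _ = α * c⁻¹ * ‖x‖ := by ring
      _ ≤ κ * ‖x‖ := by
        gcongr
        rw [hκ]
        have : 0 ≤ β * c⁻¹ ^ 2 := by positivity
        linarith
  have hL : ∀ y, ‖h.commR y‖ ≤ √κ * ‖y‖ := fun y => by
    refine abs_le_of_sq_le_sq' ?_ (by positivity) |>.2
    rw [mul_pow, Real.sq_sqrt hκ0]
    exact h.norm_commR_sq_le y
  -- For `m = R L L x`, antisymmetry of `R L` gives `‖m‖² = -⟨L m, R L x⟩`. Each of the two factors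
  -- `L` then costs `√κ`.
  have h2 : c * ‖R (h.commR (h.commR x))‖ ≤ κ * ‖x‖ := by
    set m := R (h.commR (h.commR x)) with hm
    have e : (inner ℂ m m : ℂ) = -inner ℂ (h.commR m) (R (h.commR x)) := by
      rw [← h.inner_R_commR]
      exact (h.R_symm _ _).symm
    have e' : ‖m‖ ^ 2 ≤ ‖h.commR m‖ * ‖R (h.commR x)‖ := by
      have e1 := congrArg norm e
      rw [norm_neg, inner_self_eq_norm_sq_to_K] at e1
      have e2 : ‖((‖m‖ : ℂ)) ^ 2‖ = ‖m‖ ^ 2 := by simp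
      rw [← e2]
      exact e1.le.trans (norm_inner_le_norm _ _)
    have e3 := h.c_mul_norm_R_le (h.commR x)
    have e4 : ‖m‖ * (c * ‖m‖) ≤ ‖m‖ * (κ * ‖x‖) := by
      calc ‖m‖ * (c * ‖m‖) = c * ‖m‖ ^ 2 := by ring
        _ ≤ c * (‖h.commR m‖ * ‖R (h.commR x)‖) := by gcongr
        _ = ‖h.commR m‖ * (c * ‖R (h.commR x)‖) := by ring
        _ ≤ (√κ * ‖m‖) * (√κ * ‖x‖) :=
          mul_le_mul (hL m) (e3.trans (hL x)) (by positivity) (by positivity)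
        _ = ‖m‖ * (√κ ^ 2 * ‖x‖) := by ring
        _ = _ := by rw [Real.sq_sqrt hκ0]
    rcases (norm_nonneg m).eq_or_lt with h0 | h0
    · rw [← h0, mul_zero]; positivity
    · exact le_of_mul_le_mul_left e4 h0
  rw [h.double_comm_R, map_add, norm_smul]
  have h3 := norm_add_le (R (G (R x))) (R (h.commR (h.commR x)))
  have h4 : ‖(2 : ℂ)‖ = 2 := by simp
  rw [h4]
  nlinarith

/-- The quadratic form of the double commutator of `A - c + c² R`. -/
theorem inner_double_comm (x : H) :
    inner ℂ x (-(2 : ℂ) • G x + (c : ℂ) ^ 2 • (R (T (T x)) - (2 : ℂ) • T (R (T x)) + T (T (R x))))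
    = ((-2 * (inner ℂ (A ⟨R x, h.R_mem x⟩) (G (A ⟨R x, h.R_mem x⟩))).re
      - 4 * c * (inner ℂ (A ⟨R x, h.R_mem x⟩) (G (R x))).re
      - 2 * c ^ 2 * (inner ℂ (h.commR x) (R (h.commR x))).re : ℝ) : ℂ) := by
  have real_of : ∀ {S : H →ₗ[ℂ] H}, (∀ x y, inner ℂ (S x) y = inner ℂ x (S y)) → ∀ y,
      (inner ℂ y (S y) : ℂ) = ((inner ℂ y (S y)).re : ℂ) := fun {S} hS y => by
    refine (Complex.conj_eq_iff_re.mp ?_).symm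
    rw [inner_conj_symm, hS]
  set a := A ⟨R x, h.R_mem x⟩ with ha
  have hx : x = a + (c : ℂ) • R x := by rw [ha, h.A_R]; abel
  have e1 : (inner ℂ x (R (h.commR (h.commR x))) : ℂ)
      = -inner ℂ (h.commR x) (R (h.commR x)) := by
    rw [← h.R_symm, h.inner_R_commR]
  have e2 : (inner ℂ x (R (G (R x))) : ℂ) = inner ℂ (R x) (G (R x)) := (h.R_symm _ _).symm
  -- Expansion along `x = a + c R x`. The last term is the one that cancels against `c² R G R`.
  have e3 : (inner ℂ x (G x) : ℂ) = inner ℂ a (G a) + 2 * c * ((inner ℂ a (G (R x))).re : ℂ)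
      + c ^ 2 * inner ℂ (R x) (G (R x)) := by
    have e4 : (inner ℂ (R x) (G a) : ℂ) = star (inner ℂ a (G (R x)) : ℂ) := by
      rw [← h.G_symm]; exact (inner_conj_symm _ _).symm
    have e5 := Complex.add_conj (inner ℂ a (G (R x)) : ℂ)
    conv_lhs => rw [hx]
    simp only [map_add, map_smul, inner_add_left, inner_add_right, inner_smul_left,
      inner_smul_right, Complex.conj_ofReal, e4]
    push_cast at e5
    rw [Complex.star_def]
    linear_combination (c : ℂ) * e5
  rw [h.double_comm_R, map_add, inner_add_right, inner_smul_right, inner_smul_right,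
    inner_smul_right, inner_add_right, e1, e2, e3, real_of h.R_symm (h.commR x),
    real_of h.G_symm a]
  simp only [Complex.ofReal_re]
  push_cast
  ring

/-- The lower bound on the double commutator of `A - c + c² R`. -/
theorem le_re_inner_double_comm (x : H) :
    -(6 * α) * (inner ℂ x (A ⟨R x, h.R_mem x⟩)).re - 6 * β * c⁻¹ * ‖x‖ ^ 2
    ≤ (inner ℂ x (-(2 : ℂ) • G x
        + (c : ℂ) ^ 2 • (R (T (T x)) - (2 : ℂ) • T (R (T x)) + T (T (R x))))).re := by
  have hc := h.c_pos
  have hα := h.α_nonneg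
  have hβ := h.β_nonneg
  rw [h.inner_double_comm, Complex.ofReal_re]
  set a := A ⟨R x, h.R_mem x⟩ with ha
  have hx : x = a + (c : ℂ) • R x := by rw [ha, h.A_R]; abel
  have h0 : 0 ≤ (inner ℂ (R x) a).re := h.nonneg ⟨R x, h.R_mem x⟩
  have h1 : (inner ℂ a (G a)).re ≤ α * ‖a‖ ^ 2 := by
    calc _ ≤ ‖a‖ * ‖G a‖ := re_inner_le_norm (𝕜 := ℂ) _ _
      _ ≤ ‖a‖ * (α * ‖a‖) := by gcongr; exact h.G_le a
      _ = _ := by ring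
  have h2 : (inner ℂ a (G (R x))).re ≤ α * (inner ℂ (R x) a).re + β * ‖R x‖ ^ 2 :=
    h.form_le ⟨R x, h.R_mem x⟩
  have h3 : c * (inner ℂ (h.commR x) (R (h.commR x))).re
      ≤ α * (inner ℂ (R x) a).re + β * ‖R x‖ ^ 2 := by
    refine le_trans ?_ (h.norm_commR_sq_le' x)
    calc _ ≤ c * (‖h.commR x‖ * ‖R (h.commR x)‖) := by
          gcongr; exact re_inner_le_norm (𝕜 := ℂ) _ _
      _ = ‖h.commR x‖ * (c * ‖R (h.commR x)‖) := by ring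
      _ ≤ ‖h.commR x‖ * ‖h.commR x‖ := by gcongr; exact h.c_mul_norm_R_le _
      _ = _ := by ring
  have h4 : (inner ℂ x a).re = ‖a‖ ^ 2 + c * (inner ℂ (R x) a).re := by
    conv_lhs => rw [hx]
    rw [inner_add_left, inner_smul_left, Complex.conj_ofReal, Complex.add_re,
      Complex.re_ofReal_mul]
    congr 1
    exact inner_self_eq_norm_sq (𝕜 := ℂ) _
  have h5 : c * ‖R x‖ ^ 2 ≤ c⁻¹ * ‖x‖ ^ 2 := by
    have := h.c_mul_norm_R_le x
    calc c * ‖R x‖ ^ 2 = c⁻¹ * (c * ‖R x‖) ^ 2 := by field_simp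
      _ ≤ _ := by gcongr
  have h6 := mul_le_mul_of_nonneg_left h2 hc.le
  have h7 := mul_le_mul_of_nonneg_left h3 hc.le
  have h8 := mul_le_mul_of_nonneg_left h5 hβ
  have h9 : 0 ≤ α * ‖a‖ ^ 2 := by positivity
  rw [h4]
  -- The coefficient 6 is 2 + 4 + 2 shared out: `⟨x, a⟩ = ‖a‖² + c ⟨R x, a⟩`, where `‖a‖²` occurs
  -- with weight `2 α` and `c ⟨R x, a⟩` with weight `(4 + 2) α`. The remainder `6 β c ‖R x‖²` is at
  -- most `6 β c⁻¹ ‖x‖²`.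
  nlinarith

end CommutatorData
end Abstract
-- Domains and values of the unbounded commutators
section UnboundedAlgebra

variable {H : Type*} [NormedAddCommGroup H] [InnerProductSpace ℂ H]

theorem mem_domain_opComm {S : H →ₗ.[ℂ] H} {T : H →ₗ[ℂ] H} {x : H} :
    x ∈ (opComm S (T.toPMap ⊤)).domain ↔ x ∈ S.domain ∧ T x ∈ S.domain := by
  constructor
  · rintro ⟨⟨_, h1⟩, ⟨h2, _⟩⟩
    exact ⟨h2, h1⟩
  · rintro ⟨h1, h2⟩
    exact ⟨⟨trivial, h2⟩, ⟨h1, trivial⟩⟩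

theorem opComm_apply {S : H →ₗ.[ℂ] H} {T : H →ₗ[ℂ] H} {x : H}
    (hx : x ∈ (opComm S (T.toPMap ⊤)).domain) :
    opComm S (T.toPMap ⊤) ⟨x, hx⟩ = S ⟨T x, (mem_domain_opComm.mp hx).2⟩
      - T (S ⟨x, (mem_domain_opComm.mp hx).1⟩) := rfl

theorem domain_opComm_opComm {S : H →ₗ.[ℂ] H} {T : H →ₗ[ℂ] H}
    (hT : ∀ x ∈ S.domain, T x ∈ S.domain) :
    (opComm (opComm S (T.toPMap ⊤)) (T.toPMap ⊤)).domain = S.domain := by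
  ext x
  rw [mem_domain_opComm, mem_domain_opComm, mem_domain_opComm]
  exact ⟨fun h => h.1.1, fun h => ⟨⟨h, hT x h⟩, hT x h, hT _ (hT x h)⟩⟩

theorem opComm_opComm_apply {S : H →ₗ.[ℂ] H} {T : H →ₗ[ℂ] H}
    (hT : ∀ x ∈ S.domain, T x ∈ S.domain) {x : H} (hS : x ∈ S.domain)
    (hx : x ∈ (opComm (opComm S (T.toPMap ⊤)) (T.toPMap ⊤)).domain) :
    opComm (opComm S (T.toPMap ⊤)) (T.toPMap ⊤) ⟨x, hx⟩
      = S ⟨T (T x), hT _ (hT x hS)⟩ - (2 : ℂ) • T (S ⟨T x, hT x hS⟩) + T (T (S ⟨x, hS⟩)) := by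
  rw [opComm_apply, opComm_apply, opComm_apply, map_sub, two_smul]
  abel

namespace CommutatorData

variable {A : H →ₗ.[ℂ] H} {R T G : H →ₗ[ℂ] H} {c α β : ℝ} (h : CommutatorData A R T G c α β)
include h

/-- Identifies the partially defined inverse with the everywhere defined `R`, so that all further
domains can be read off from `R`. -/
theorem resolventInv_eq : resolventInv A c = R.toPMap ⊤ := by
  have hker : (A + opScalar c).toFun.ker = ⊥ := by
    refine LinearMap.ker_eq_bot'.mpr fun u hu => ?_
    have hu' : A ⟨u.1, u.2.1⟩ + (c : ℂ) • (u : H) = 0 := hu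
    have := h.R_A ⟨u.1, u.2.1⟩
    rw [hu', map_zero] at this
    exact Subtype.ext this.symm
  have hmem : ∀ x, R x ∈ (A + opScalar c).domain := fun x =>
    Submodule.mem_inf.mpr ⟨h.R_mem x, trivial⟩
  have key : ∀ x, (A + opScalar c : H →ₗ.[ℂ] H) ⟨R x, hmem x⟩ = x := fun x => by
    change A ⟨R x, h.R_mem x⟩ + (c : ℂ) • R x = x
    rw [h.A_R, sub_add_cancel]
  refine LinearPMap.ext ?_ fun x hx hx' => ?_
  · rw [resolventInv, LinearPMap.inverse_domain, LinearMap.toPMap_domain]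
    exact eq_top_iff.mpr fun x _ => ⟨_, key x⟩
  · exact LinearPMap.inverse_apply_eq hker (y := ⟨x, hx⟩) (key x)

theorem domain_opFrac : (opFrac A c).domain = ⊤ := by
  rw [opFrac, h.resolventInv_eq]
  exact eq_top_iff.mpr fun x _ => ⟨trivial, h.R_mem x⟩

theorem opFrac_apply (x : (opFrac A c).domain) :
    opFrac A c x = A ⟨R x, h.R_mem x⟩ := by
  obtain ⟨x, hx⟩ := x
  -- Generalizing over `Q` allows the substitution of `R` although the membership proof `hx` depends
  -- on the operator.
  have key : ∀ (Q : H →ₗ.[ℂ] H) (hQ : Q = R.toPMap ⊤) (hx : x ∈ (opMul A Q).domain),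
      opMul A Q ⟨x, hx⟩ = A ⟨R x, h.R_mem x⟩ := by
    rintro _ rfl hx; rfl
  exact key _ h.resolventInv_eq hx

/-- `A R x = x - c R x` with `R x` in the domain of `A`, so `A R x` lies in that domain exactly when
`x` does. -/
theorem domain_opSqFrac : (opSqFrac A c).domain = A.domain := by
  have key : ∀ x, x - (c : ℂ) • R x ∈ A.domain ↔ x ∈ A.domain := fun x =>
    Submodule.sub_mem_iff_left _ (A.domain.smul_mem _ (h.R_mem x))
  rw [opSqFrac, h.resolventInv_eq]
  ext x
  constructor
  · rintro ⟨_, h1, h2⟩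
    have h2' : A ⟨R x, h.R_mem x⟩ ∈ A.domain := h2
    rwa [h.A_R, key] at h2'
  · intro hx
    refine ⟨trivial, h.R_mem x, ?_⟩
    change A ⟨R x, h.R_mem x⟩ ∈ A.domain
    rwa [h.A_R, key]

theorem opSqFrac_apply (x : (opSqFrac A c).domain) :
    opSqFrac A c x = A ⟨x, h.domain_opSqFrac ▸ x.2⟩ - (c : ℂ) • (x : H)
      + (c : ℂ) ^ 2 • R x := by
  obtain ⟨x, hx⟩ := x
  have key : ∀ (Q : H →ₗ.[ℂ] H) (_ : Q = R.toPMap ⊤) (hx : x ∈ (opMul (opMul A A) Q).domain),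
      ∃ h' : A ⟨R x, h.R_mem x⟩ ∈ A.domain,
      opMul (opMul A A) Q ⟨x, hx⟩ = A ⟨A ⟨R x, h.R_mem x⟩, h'⟩ := by
    rintro _ rfl hx
    exact ⟨hx.2.2, rfl⟩
  obtain ⟨h', e⟩ := key _ h.resolventInv_eq hx
  have hxA : x ∈ A.domain := h.domain_opSqFrac ▸ hx
  have e2 : A ⟨A ⟨R x, h.R_mem x⟩, h'⟩ = A (⟨x, hxA⟩ - (c : ℂ) • ⟨R x, h.R_mem x⟩) := by
    congr 1
    ext
    exact h.A_R x
  refine e.trans ?_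
  rw [e2, A.map_sub, A.map_smul, h.A_R, smul_sub, smul_smul, sq]
  abel

theorem domain_double_opComm_opSqFrac :
    (opComm (opComm (opSqFrac A c) (T.toPMap ⊤)) (T.toPMap ⊤)).domain = A.domain := by
  rw [domain_opComm_opComm, h.domain_opSqFrac]
  rw [h.domain_opSqFrac]
  exact fun x hx => h.T_mem ⟨x, hx⟩

theorem double_opComm_opSqFrac_apply
    (x : (opComm (opComm (opSqFrac A c) (T.toPMap ⊤)) (T.toPMap ⊤)).domain) :
    opComm (opComm (opSqFrac A c) (T.toPMap ⊤)) (T.toPMap ⊤) x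
      = -(2 : ℂ) • G x
        + (c : ℂ) ^ 2 • (R (T (T x)) - (2 : ℂ) • T (R (T x)) + T (T (R x))) := by
  obtain ⟨x, hx⟩ := x
  have hT : ∀ x ∈ (opSqFrac A c).domain, T x ∈ (opSqFrac A c).domain := by
    rw [h.domain_opSqFrac]
    exact fun x hx => h.T_mem ⟨x, hx⟩
  have hxA : x ∈ A.domain := h.domain_double_opComm_opSqFrac ▸ hx
  rw [opComm_opComm_apply hT (h.domain_opSqFrac ▸ hxA), h.opSqFrac_apply, h.opSqFrac_apply,
    h.opSqFrac_apply]
  rw [← h.double_comm ⟨x, hxA⟩]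
  simp only [map_add, map_sub, map_smul]
  module

theorem domain_double_opComm_opFrac :
    (opComm (opComm (opFrac A c) (T.toPMap ⊤)) (T.toPMap ⊤)).domain = ⊤ := by
  rw [domain_opComm_opComm, h.domain_opFrac]
  rw [h.domain_opFrac]
  exact fun _ _ => trivial

theorem double_opComm_opFrac_apply
    (x : (opComm (opComm (opFrac A c) (T.toPMap ⊤)) (T.toPMap ⊤)).domain) :
    opComm (opComm (opFrac A c) (T.toPMap ⊤)) (T.toPMap ⊤) x
      = -(c : ℂ) • (R (T (T x)) - (2 : ℂ) • T (R (T x)) + T (T (R x))) := by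
  obtain ⟨x, hx⟩ := x
  have hT : ∀ x ∈ (opFrac A c).domain, T x ∈ (opFrac A c).domain := by
    rw [h.domain_opFrac]
    exact fun _ _ => trivial
  have hxA : x ∈ (opFrac A c).domain := by rw [h.domain_opFrac]; trivial
  rw [opComm_opComm_apply hT hxA, h.opFrac_apply, h.opFrac_apply, h.opFrac_apply,
    h.A_R, h.A_R, h.A_R]
  simp only [map_sub, map_smul]
  module

theorem opLE_double_opComm {a b : ℝ} (ha : 6 * α ≤ a) (hb : 6 * β * c⁻¹ ≤ b) :
    OpLE ((-(a : ℂ)) • opFrac A c - opScalar b)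
      (opComm (opComm (opSqFrac A c) (T.toPMap ⊤)) (T.toPMap ⊤)) := by
  have hdom : ∀ x : H, x ∈ ((-(a : ℂ)) • opFrac A c - opScalar b).domain := fun x =>
    ⟨(h.domain_opFrac ▸ trivial : x ∈ (opFrac A c).domain), trivial⟩
  refine ⟨fun x _ => hdom x, fun u => ?_⟩
  have e : ((-(a : ℂ)) • opFrac A c - opScalar b : H →ₗ.[ℂ] H) ⟨u, hdom u⟩
      = -(a : ℂ) • A ⟨R u, h.R_mem u⟩ - (b : ℂ) • (u : H) := by
    rw [← h.opFrac_apply ⟨u, (hdom u).1⟩]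
    rfl
  have e0 : (inner ℂ (u : H) (u : H) : ℂ) = ((‖(u : H)‖ ^ 2 : ℝ) : ℂ) := by
    rw [inner_self_eq_norm_sq_to_K]; norm_cast
  have e1 : (inner ℂ (u : H) (A ⟨R u, h.R_mem u⟩)).im = 0 := by
    have h1 : (inner ℂ (u : H) (R u)).im = 0 := by
      refine Complex.conj_eq_iff_im.mp ?_
      rw [inner_conj_symm, h.R_symm]
    rw [h.A_R, inner_sub_right, inner_smul_right, e0, Complex.sub_im, Complex.im_ofReal_mul, h1,
      Complex.ofReal_im]
    ring
  -- Positivity of `A R` is what allows the coefficient `6 α` to be enlarged to `a`.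
  have e2 : 0 ≤ (inner ℂ (u : H) (A ⟨R u, h.R_mem u⟩)).re := by
    have h1 : (inner ℂ (u : H) (R u)).re ≤ ‖(u : H)‖ * ‖R u‖ := re_inner_le_norm (𝕜 := ℂ) _ _
    rw [h.A_R, inner_sub_right, inner_smul_right, e0, Complex.sub_re, Complex.re_ofReal_mul,
      Complex.ofReal_re]
    have h2 := mul_le_mul_of_nonneg_left h1 h.c_pos.le
    have h3 := mul_le_mul_of_nonneg_left (h.c_mul_norm_R_le u) (norm_nonneg (u : H))
    nlinarith
  have e3 := h.le_re_inner_double_comm u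
  have e4 := congrArg Complex.im (h.inner_double_comm u)
  rw [Complex.ofReal_im] at e4
  rw [e, h.double_opComm_opSqFrac_apply, inner_sub_right, inner_sub_right, inner_smul_right,
    inner_smul_right, e0, ← Complex.ofReal_neg]
  simp only [Complex.sub_im, Complex.sub_re, Complex.im_ofReal_mul, Complex.re_ofReal_mul,
    Complex.ofReal_re, Complex.ofReal_im, e4, e1]
  refine ⟨by ring, ?_⟩
  have e5 := mul_le_mul_of_nonneg_right ha e2
  have e6 := mul_le_mul_of_nonneg_right hb (sq_nonneg ‖(u : H)‖)
  linarith

theorem norm_double_opComm_opFrac_le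
    (u : (opComm (opComm (opFrac A c) (T.toPMap ⊤)) (T.toPMap ⊤)).domain) :
    ‖opComm (opComm (opFrac A c) (T.toPMap ⊤)) (T.toPMap ⊤) u‖
      ≤ 4 * (α * c⁻¹ + β * c⁻¹ ^ 2) * ‖(u : H)‖ := by
  rw [h.double_opComm_opFrac_apply, norm_smul, norm_neg, Complex.norm_real,
    Real.norm_of_nonneg h.c_pos.le]
  exact h.norm_double_comm_R_le u

end CommutatorData

end UnboundedAlgebra

/-! ### Integration by parts for two weakly differentiable functions -/

section IntegrationByParts

/-- The correlation `h ↦ ∫ a(x) b(x + h) dx`. -/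
noncomputable def correlation (a b : E3 → ℂ) (h : E3) : ℂ := ∫ x, a x * b (x + h)

/-- The correlation is an `L²` inner product with a translate of `b`, and translation is continuous
in `L²`. -/
theorem continuous_correlation {a b : E3 → ℂ} (ha : MemLp a 2) (hb : MemLp b 2) :
    Continuous (correlation a b) := by
  have hmp : ∀ h : E3, MeasurePreserving (fun x : E3 => x + h) volume volume :=
    fun h => measurePreserving_add_right volume h
  let T : E3 → C(E3, E3) := fun h => ⟨fun x => x + h, by fun_prop⟩
  have hT : Continuous T :=
    ContinuousMap.continuous_of_continuous_uncurry _ (by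
      change Continuous fun p : E3 × E3 => p.2 + p.1
      fun_prop)
  have h1 : Continuous fun h => Lp.compMeasurePreserving (T h) (hmp h) (hb.toLp b) :=
    continuous_const.compMeasurePreservingLp hT hmp (by norm_num)
  have h2 : correlation a b = fun h =>
      inner ℂ (ha.star.toLp (star a)) (Lp.compMeasurePreserving (T h) (hmp h) (hb.toLp b)) := by
    funext h
    rw [Lp.toLp_compMeasurePreserving, L2.inner_def]
    refine integral_congr_ae ?_
    filter_upwards [ha.star.coeFn_toLp, (hb.comp_measurePreserving (hmp h)).coeFn_toLp]
      with x hx hx'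
    erw [hx, hx']
    simp [RCLike.inner_apply, mul_comm]
  rw [h2]
  exact continuous_const.inner h1

theorem integrable_mul_kernel {a b : E3 → ℂ} {k : E3 → ℝ} (ha : Integrable a)
    (hb : Integrable b) (hk : Continuous k) (hks : HasCompactSupport k) :
    Integrable (fun p : E3 × E3 => a p.1 * (k (p.2 - p.1) • b p.2)) (volume.prod volume) := by
  obtain ⟨B, hB⟩ := hk.bounded_above_of_compact_support hks
  have h1 : Continuous fun p : E3 × E3 => k (p.2 - p.1) := by fun_prop
  have h2 := (ha.mul_prod hb).bdd_smul (𝕜 := ℝ) B h1.aestronglyMeasurable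
    (Filter.Eventually.of_forall fun p => hB _)
  refine h2.congr (Filter.Eventually.of_forall fun p => ?_)
  simp only [Complex.real_smul, Pi.smul_apply']
  ring

/-- Fubini after the substitution `y = x + h`. -/
theorem integral_kernel_eq_correlation {a b : E3 → ℂ} {k : E3 → ℝ} (ha : Integrable a)
    (hb : Integrable b) (hk : Continuous k) (hks : HasCompactSupport k) :
    ∫ x, a x * ∫ y, k (y - x) • b y = ∫ h, k h • correlation a b h := by
  have h1 : ∀ x, a x * ∫ y, k (y - x) • b y = ∫ h, a x * (k h • b (x + h)) := fun x => by
    rw [← integral_const_mul, ← integral_add_left_eq_self _ x]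
    simp only [add_sub_cancel_left]
  simp_rw [h1]
  have hmp := measurePreserving_prod_add (volume : Measure E3) (volume : Measure E3)
  have h2 := hmp.integrable_comp_of_integrable (integrable_mul_kernel ha hb hk hks)
  rw [integral_integral_swap]
  · refine integral_congr_ae (Filter.Eventually.of_forall fun h => ?_)
    simp only [correlation]
    rw [← integral_smul]
    congr 1
    funext x
    simp only [Complex.real_smul]
    ring
  · refine h2.congr (Filter.Eventually.of_forall fun p => ?_)
    simp [Function.uncurry]

theorem pderiv_comp_sub_left {φ : E3 → ℝ} (hφ : ContDiff ℝ ∞ φ) (i : Fin 3) (y x : E3) :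
    pderiv i (fun x => φ (y - x)) x = -pderiv i φ (y - x) := by
  have h1 : HasFDerivAt (fun x => φ (y - x)) _ x :=
    ((hφ.differentiable (by simp) (y - x)).hasFDerivAt).comp x
      ((hasFDerivAt_id x).const_sub y)
  rw [pderiv, h1.fderiv, pderiv]
  simp

/-- Integration by parts: `∂ᵢ` is skew on square integrable functions, where `f'` is the weak
derivative of `f` on the whole space, and `g'` is the weak derivative of `g` near the support
of `f`. -/
theorem integral_mul_weakDeriv {f f' g g' : E3 → ℂ} {i : Fin 3} {K : Set E3} {ε : ℝ}
    (hε : 0 < ε) (hf : MemLp f 2) (hf' : MemLp f' 2) (hg : MemLp g 2) (hg' : MemLp g' 2)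
    (hf1 : Integrable f) (hf1' : Integrable f') (hg1 : Integrable g) (hg1' : Integrable g')
    (hK : ∀ x ∉ K, f x = 0)
    (hff : ∀ φ : E3 → ℝ, IsTest Set.univ φ → ∫ x, pderiv i φ x • f x = -∫ x, φ x • f' x)
    (hgg : ∀ φ : E3 → ℝ, IsTest (Metric.ball 0 ε) φ → ∀ x ∈ K,
      ∫ y, pderiv i φ (y - x) • g y = -∫ y, φ (y - x) • g' y) :
    ∫ x, f x * g' x = -∫ x, f' x * g x := by
  -- The function `correlation f' g + correlation f g'` vanishes weakly near 0. With the kernel `φ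
  -- (y - x)`, the derivative is moved from `g` to `φ` in the variable `y`, which is needed only for
  -- `x ∈ K`, and then from `φ` to `f` in the variable `x`. The two signs differ because `∂ₓ` of the
  -- kernel is minus `∂ᵧ`.
  have key : ∀ φ : E3 → ℝ, IsTest (Metric.ball 0 ε) φ →
      ∫ h, φ h • (correlation f' g h + correlation f g' h) = 0 := fun φ hφ => by
    have hc := hφ.smooth.continuous
    have i1 : ∀ a b : E3 → ℂ, MemLp a 2 → MemLp b 2 →
        Integrable fun h => φ h • correlation a b h := fun a b ha hb =>
      (hc.smul (continuous_correlation ha hb)).integrable_of_hasCompactSupport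
        hφ.compact.smul_right
    simp_rw [smul_add]
    rw [integral_add (i1 _ _ hf' hg) (i1 _ _ hf hg'),
      ← integral_kernel_eq_correlation hf1 hg1' hc hφ.compact,
      ← integral_kernel_eq_correlation hf1' hg1 hc hφ.compact]
    have e1 : ∫ x, f x * ∫ y, φ (y - x) • g' y = -∫ x, f x * ∫ y, pderiv i φ (y - x) • g y := by
      rw [← integral_neg]
      congr 1
      funext x
      by_cases hx : x ∈ K
      · rw [hgg φ hφ x hx]; ring
      · rw [hK x hx]; ring
    have swap : ∀ (a b : E3 → ℂ) (k : E3 → ℝ), Integrable a → Integrable b → Continuous k →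
        HasCompactSupport k → ∫ x, a x * ∫ y, k (y - x) • b y
          = ∫ y, b y * ∫ x, k (y - x) • a x := fun a b k ha hb hk hks => by
      simp_rw [← integral_const_mul]
      rw [integral_integral_swap (integrable_mul_kernel ha hb hk hks)]
      congr 1; funext y; congr 1; funext x
      simp only [Complex.real_smul]
      ring
    rw [e1, swap f g _ hf1 hg1 (hφ.pderiv_continuous i) (hφ.pderiv_compact i),
      swap f' g _ hf1' hg1 hc hφ.compact]
    have e2 : ∀ y, ∫ x, pderiv i φ (y - x) • f x = ∫ x, φ (y - x) • f' x := fun y => by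
      have ht : IsTest Set.univ fun x => φ (y - x) :=
        ⟨hφ.smooth.comp (contDiff_const.sub contDiff_id),
          hφ.compact.comp_homeomorph (Homeomorph.subLeft y), Set.subset_univ _⟩
      have := hff _ ht
      simp_rw [pderiv_comp_sub_left hφ.smooth, neg_smul, integral_neg] at this
      exact neg_injective this
    simp_rw [e2]
    ring
  have hcont : Continuous fun h => correlation f' g h + correlation f g' h :=
    (continuous_correlation hf' hg).add (continuous_correlation hf hg')
  have hae := Metric.isOpen_ball.ae_eq_zero_of_integral_contDiff_smul_eq_zero
    (U := Metric.ball (0 : E3) ε) (μ := volume) (hcont.locallyIntegrable.locallyIntegrableOn _)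
    fun φ h1 h2 h3 => key φ ⟨h1, h2, h3⟩
  -- A continuous function that vanishes almost everywhere on a ball vanishes at its centre, and the
  -- value at `h = 0` is the claim.
  have hzero : correlation f' g 0 + correlation f g' 0 = 0 := by
    have hae' : (fun h => correlation f' g h + correlation f g' h)
        =ᵐ[volume.restrict (Metric.ball 0 ε)] fun _ => 0 := by
      rw [Filter.EventuallyEq, ae_restrict_iff' Metric.isOpen_ball.measurableSet]
      exact hae
    exact Measure.eqOn_open_of_ae_eq hae' Metric.isOpen_ball hcont.continuousOn
      continuousOn_const (Metric.mem_ball_self hε)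
  simp only [correlation, add_zero] at hzero
  exact eq_neg_of_add_eq_zero_right hzero

end IntegrationByParts

/-! ### Bounded multiplication operators on `L²(O)` -/

section Multipliers

/-- `ψ` is measurable and bounded on `O`. -/
structure IsMultiplier (O : Set E3) (ψ : E3 → ℝ) : Prop where
  aesm : AEStronglyMeasurable ψ (volume.restrict O)
  bdd : ∃ B, ∀ᵐ x ∂volume.restrict O, |ψ x| ≤ B

variable {O : Set E3} {ψ : E3 → ℝ}

theorem IsMultiplier.memLp (h : IsMultiplier O ψ) (u : L2 O) :
    MemLp (fun x => (ψ x : ℂ) * u x) 2 (volume.restrict O) := by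
  obtain ⟨B, hB⟩ := h.bdd
  refine (Lp.memLp u).of_le_mul (c := B)
    ((Complex.continuous_ofReal.comp_aestronglyMeasurable h.aesm).mul (Lp.aestronglyMeasurable u))
    ?_
  filter_upwards [hB] with x hx
  rw [norm_mul, Complex.norm_real]
  exact mul_le_mul_of_nonneg_right hx (norm_nonneg _)

theorem norm_toLp_mul_le (h : IsMultiplier O ψ) {B : ℝ}
    (hB : ∀ᵐ x ∂volume.restrict O, |ψ x| ≤ B) (u : L2 O) :
    ‖(h.memLp u).toLp _‖ ≤ B * ‖u‖ := by
  refine Lp.norm_le_mul_norm_of_ae_le_mul ?_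
  filter_upwards [hB, (h.memLp u).coeFn_toLp] with x hx hx'
  rw [hx', norm_mul, Complex.norm_real]
  exact mul_le_mul_of_nonneg_right hx (norm_nonneg _)

/-- Multiplication by a bounded function, as a bounded operator on `L²(O)`. -/
noncomputable def mulCLM (h : IsMultiplier O ψ) : L2 O →L[ℂ] L2 O :=
  LinearMap.mkContinuousOfExistsBound
    { toFun := fun u => (h.memLp u).toLp _
      map_add' := fun u v => by
        rw [← MemLp.toLp_add (h.memLp u) (h.memLp v)]
        exact MemLp.toLp_congr _ _ (mul_add_ae ψ u v)
      map_smul' := fun c u => by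
        rw [RingHom.id_apply, ← MemLp.toLp_const_smul c (h.memLp u)]
        exact MemLp.toLp_congr _ _ (mul_smul_ae ψ c u) }
    (h.bdd.imp fun _ hB u => norm_toLp_mul_le h hB u)

theorem mulCLM_ae (h : IsMultiplier O ψ) (u : L2 O) :
    mulCLM h u =ᵐ[volume.restrict O] fun x => (ψ x : ℂ) * u x :=
  (h.memLp u).coeFn_toLp

theorem norm_mulCLM_le (h : IsMultiplier O ψ) (hO : IsOpen O) {B : ℝ}
    (hB : ∀ x ∈ O, |ψ x| ≤ B) (u : L2 O) : ‖mulCLM h u‖ ≤ B * ‖u‖ :=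
  norm_toLp_mul_le h ((ae_restrict_mem hO.measurableSet).mono hB) u

theorem inner_mulCLM (h : IsMultiplier O ψ) (u v : L2 O) :
    inner ℂ (mulCLM h u) v = inner ℂ u (mulCLM h v) := by
  rw [L2.inner_def, L2.inner_def]
  refine integral_congr_ae ?_
  filter_upwards [mulCLM_ae h u, mulCLM_ae h v] with x hu hv
  rw [hu, hv, RCLike.inner_apply, RCLike.inner_apply, map_mul, Complex.conj_ofReal]
  ring

theorem mulCLM_comm {φ : E3 → ℝ} (h : IsMultiplier O ψ) (h' : IsMultiplier O φ) (u : L2 O) :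
    mulCLM h (mulCLM h' u) = mulCLM h' (mulCLM h u) := by
  refine Lp.ext ?_
  filter_upwards [mulCLM_ae h u, mulCLM_ae h' u, mulCLM_ae h (mulCLM h' u),
    mulCLM_ae h' (mulCLM h u)] with x h1 h2 h3 h4
  rw [h3, h4, h1, h2]
  ring

theorem mulOp_eq (h : IsMultiplier O ψ) :
    mulOp O ψ = (mulCLM h : L2 O →ₗ[ℂ] L2 O).toPMap ⊤ :=
  LinearPMap.ext (eq_top_iff.mpr fun u _ => h.memLp u) fun _ _ _ => rfl

theorem IsMultiplier.of_continuousOn (hO : IsOpen O) (hc : ContinuousOn ψ O) {B : ℝ}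
    (hB : ∀ x ∈ O, |ψ x| ≤ B) : IsMultiplier O ψ :=
  ⟨hc.aestronglyMeasurable hO.measurableSet, B, (ae_restrict_mem hO.measurableSet).mono hB⟩

theorem IsMultiplier.of_compact (hc : Continuous ψ) (hs : HasCompactSupport ψ) :
    IsMultiplier O ψ := by
  obtain ⟨B, hB⟩ := hc.bounded_above_of_compact_support hs
  exact ⟨hc.aestronglyMeasurable, B, Filter.Eventually.of_forall hB⟩

theorem IsTest.isMultiplier {U : Set E3} (h : IsTest U ψ) : IsMultiplier O ψ :=
  .of_compact h.smooth.continuous h.compact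

theorem IsTest.pderiv_isMultiplier {U : Set E3} (h : IsTest U ψ) (i : Fin 3) :
    IsMultiplier O (pderiv i ψ) :=
  .of_compact (h.pderiv_continuous i) (h.pderiv_compact i)

end Multipliers

/-! ### The weak Leibniz rule and integration by parts with a cut-off -/

section ProductRule

variable {O : Set E3} {ψ ψ' : E3 → ℝ}

theorem pderiv_mul {φ : E3 → ℝ} {x : E3} (i : Fin 3) (hφ : DifferentiableAt ℝ φ x)
    (hψ : DifferentiableAt ℝ ψ x) :
    pderiv i (fun x => φ x * ψ x) x = pderiv i φ x * ψ x + φ x * pderiv i ψ x := by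
  rw [pderiv, fderiv_fun_mul hφ hψ]
  simp [pderiv]
  ring

/-- The weak Leibniz rule, tested against `φ` such that `φ ψ` is a test function. -/
theorem integral_pderiv_mulCLM {φ : E3 → ℝ} {i : Fin 3} {u p : L2 O} (hO : IsOpen O)
    (hu : IsWeakPartial O i u p) (hφ : ContDiff ℝ ∞ φ) (hφc : HasCompactSupport φ)
    (hφψ : IsTest O fun x => φ x * ψ x) (hψd : ∀ x ∈ O, DifferentiableAt ℝ ψ x)
    (hψ' : ∀ x ∈ O, pderiv i ψ x = ψ' x) (h : IsMultiplier O ψ) (h' : IsMultiplier O ψ') :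
    ∫ x in O, pderiv i φ x • mulCLM h u x
      = -∫ x in O, φ x • (mulCLM h p + mulCLM h' u : L2 O) x := by
  rw [integral_smul_add hφ.continuous hφc, neg_add]
  have e1 : ∫ x in O, φ x • mulCLM h p x = ∫ x in O, (φ x * ψ x) • p x := by
    refine integral_congr_ae ?_
    filter_upwards [mulCLM_ae h p] with x hx
    rw [hx]
    simp only [Complex.real_smul]
    push_cast
    ring
  rw [e1, ← hu _ hφψ, ← integral_neg, ← integral_add]
  · refine integral_congr_ae ?_
    filter_upwards [mulCLM_ae h u, mulCLM_ae h' u, ae_restrict_mem hO.measurableSet]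
      with x hx hx' hxO
    rw [hx, hx', pderiv_mul i (hφ.differentiable (by simp) x) (hψd x hxO), hψ' x hxO]
    simp only [Complex.real_smul]
    push_cast
    ring
  · exact integrable_smul (hφψ.pderiv_continuous i) (hφψ.pderiv_compact i) u
  · exact (integrable_smul hφ.continuous hφc _).neg

/-- Although `ψ` is smooth only on `O`, the product is smooth everywhere, because `φ` vanishes in a
neighbourhood of every point outside `O`. -/
theorem IsTest.mul_contDiffOn {φ : E3 → ℝ} (hO : IsOpen O) (hφ : IsTest O φ)
    (hψ : ContDiffOn ℝ ∞ ψ O) : IsTest O fun x => φ x * ψ x where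
  smooth := by
    refine contDiff_iff_contDiffAt.mpr fun x => ?_
    by_cases hx : x ∈ O
    · exact hφ.smooth.contDiffAt.mul (hψ.contDiffAt (hO.mem_nhds hx))
    · have h0 : (fun x => φ x * ψ x) =ᶠ[nhds x] fun _ => 0 := by
        have := notMem_tsupport_iff_eventuallyEq.mp fun h => hx (hφ.support h)
        filter_upwards [this] with y hy
        rw [hy, Pi.zero_apply, zero_mul]
      exact contDiffAt_const.congr_of_eventuallyEq h0
  compact := hφ.compact.mul_right
  support := (closure_mono (Function.support_mul_subset_left φ ψ)).trans hφ.support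

/-- The Leibniz rule for the weak gradient. -/
theorem IsWeakGrad.mulCLM {ψ' : Fin 3 → E3 → ℝ} {u : L2 O} {p : Fin 3 → L2 O} (hO : IsOpen O)
    (hu : IsWeakGrad O u p) (hψ : ContDiffOn ℝ ∞ ψ O)
    (hψ' : ∀ i, ∀ x ∈ O, pderiv i ψ x = ψ' i x) (h : IsMultiplier O ψ)
    (h' : ∀ i, IsMultiplier O (ψ' i)) :
    IsWeakGrad O (mulCLM h u) fun i => mulCLM h (p i) + mulCLM (h' i) u := fun i φ hφ =>
  integral_pderiv_mulCLM hO (hu i) hφ.smooth hφ.compact (hφ.mul_contDiffOn hO hψ)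
    (fun x hx => (hψ.contDiffAt (hO.mem_nhds hx)).differentiableAt (by simp)) (hψ' i) h (h' i)

theorem integral_smul_indicator (hO : IsOpen O) (k : E3 → ℝ) (w : E3 → ℂ) :
    ∫ x, k x • O.indicator w x = ∫ x in O, k x • w x := by
  rw [← integral_indicator hO.measurableSet]
  congr 1
  funext x
  exact (Set.indicator_smul_apply O k w x).symm

/-- Integration by parts in `H¹(O)` with a cut-off function. -/
theorem IsTest.inner_weakPartial {χ : E3 → ℝ} {i : Fin 3} {u p v q : L2 O} (hO : IsOpen O)
    (hb : Bornology.IsBounded O) (hχ : IsTest O χ) (hu : IsWeakPartial O i u p)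
    (hv : IsWeakPartial O i v q) :
    inner ℂ q (mulCLM hχ.isMultiplier u)
      = -inner ℂ v (mulCLM hχ.isMultiplier p + mulCLM (hχ.pderiv_isMultiplier i) u) := by
  set w := mulCLM hχ.isMultiplier p + mulCLM (hχ.pderiv_isMultiplier i) u with hw
  -- Boundedness of `O` puts `L²(O)` inside `L¹(O)`, which the Fubini arguments require.
  have hfin : IsFiniteMeasure (volume.restrict O) := ⟨by
    rw [Measure.restrict_apply_univ]; exact hb.measure_lt_top⟩
  -- A test function supported in the `ε`-ball and translated by a point of `tsupport χ` is still a
  -- test function on `O`, so the weak derivative of `v` may be tested against it.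
  obtain ⟨ε, hε, hεO⟩ := hχ.compact.isCompact.exists_thickening_subset_open hO hχ.support
  have m2 : ∀ {a : E3 → ℂ}, MemLp a 2 (volume.restrict O) → MemLp (O.indicator a) 2 :=
    fun ha => (memLp_indicator_iff_restrict hO.measurableSet).mpr ha
  have m1 : ∀ {a : E3 → ℂ}, MemLp a 2 (volume.restrict O) → Integrable (O.indicator a) :=
    fun ha => (integrable_indicator_iff hO.measurableSet).mpr (ha.integrable (by norm_num))
  have hmf := (hχ.isMultiplier (O := O)).memLp u
  have key := integral_mul_weakDeriv (i := i) (K := tsupport χ) hε (m2 hmf) (m2 (Lp.memLp w))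
    (m2 (Lp.memLp v).star) (m2 (Lp.memLp q).star) (m1 hmf) (m1 (Lp.memLp w))
    (m1 (Lp.memLp v).star) (m1 (Lp.memLp q).star)
    (fun x hx => by simp [Set.indicator, image_eq_zero_of_notMem_tsupport hx])
    (fun φ hφ => by
      have ht : IsTest O fun x => φ x * χ x :=
        ⟨hφ.smooth.mul hχ.smooth, hχ.compact.mul_left,
          (closure_mono (Function.support_mul_subset_right φ χ)).trans hχ.support⟩
      rw [integral_smul_indicator hO, integral_smul_indicator hO, hw,
        ← integral_pderiv_mulCLM hO hu hφ.smooth hφ.compact ht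
          (fun x _ => hχ.smooth.differentiable (by simp) x) (fun _ _ => rfl)]
      refine integral_congr_ae ?_
      filter_upwards [mulCLM_ae hχ.isMultiplier u] with x hx
      rw [hx])
    (fun φ hφ x hx => by
      have ht : IsTest O fun y => φ (y - x) := by
        refine ⟨hφ.smooth.comp (contDiff_id.sub contDiff_const),
          hφ.compact.comp_homeomorph (Homeomorph.subRight x), fun y hy => hεO ?_⟩
        have h1 : y - x ∈ tsupport φ :=
          tsupport_comp_subset_preimage φ (f := fun y => y - x) (by fun_prop) hy
        have h2 := hφ.support h1
        rw [mem_ball_zero_iff] at h2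
        exact Metric.mem_thickening_iff.mpr ⟨x, hx, by rwa [dist_eq_norm]⟩
      have hd : ∀ y, pderiv i (fun y => φ (y - x)) y = pderiv i φ (y - x) := fun y => by
        rw [pderiv, fderiv_comp_sub, pderiv]
      have h3 := hv _ ht
      simp_rw [hd] at h3
      have cj : ∀ (k : E3 → ℝ) (a : L2 O), ∫ y, k y • O.indicator (star (a : E3 → ℂ)) y
          = star (∫ y in O, k y • a y) := fun k a => by
        rw [integral_smul_indicator hO, Complex.star_def, ← integral_conj]
        congr 1
        funext y
        simp
      rw [cj (fun y => pderiv i φ (y - x)), cj (fun y => φ (y - x)), h3, star_neg])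
  have hprod : ∀ a b : E3 → ℂ, ∫ x, O.indicator a x * O.indicator b x = ∫ x in O, a x * b x :=
    fun a b => by
      rw [← integral_indicator hO.measurableSet]
      congr 1
      funext x
      by_cases hx : x ∈ O <;> simp [hx]
  rw [hprod, hprod] at key
  rw [L2.inner_def, L2.inner_def]
  refine Eq.trans (integral_congr_ae ?_) (key.trans (congrArg _ (integral_congr_ae ?_)))
  · filter_upwards [mulCLM_ae hχ.isMultiplier u] with x hx
    rw [hx, RCLike.inner_apply]
    rfl
  · filter_upwards with x
    rw [RCLike.inner_apply]
    rfl

end ProductRule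

/-! ### Symmetry and resolvent of the Neumann Laplacian -/

section Neumann

variable {O : Set E3}

theorem inner_toLp_ofReal {ψ : E3 → ℝ} (hc : Continuous ψ) (hs : HasCompactSupport ψ)
    (u : L2 O) : inner ℂ ((memLp_ofReal hc hs).toLp _ : L2 O) u = ∫ x in O, ψ x • u x := by
  rw [L2.inner_def]
  refine integral_congr_ae ?_
  filter_upwards [(memLp_ofReal (O := O) hc hs).coeFn_toLp] with x hx
  rw [hx, Complex.real_smul, RCLike.inner_apply, Complex.conj_ofReal, mul_comm]

/-- The graph of the scaled weak gradient `k⁻¹ ∇`, as a subspace of a Hilbert space. -/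
def gradGraph (O : Set E3) (k : ℂ) : Submodule ℂ (PiLp 2 fun _ : Option (Fin 3) => L2 O) where
  carrier := {z | IsWeakGrad O (z none) fun i => k • z (some i)}
  zero_mem' := by
    have := IsWeakGrad.zero (O := O)
    simpa [Pi.zero_def] using this
  add_mem' {y z} hy hz := by
    have := IsWeakGrad.add hy hz
    simpa [Pi.add_def] using this
  smul_mem' c z hz := by
    have := IsWeakGrad.smul c hz
    simpa [Pi.smul_def, smul_comm k c] using this

/-- Each defining condition equates two continuous functionals, inner products against fixed test
functions. -/
theorem isClosed_gradGraph (O : Set E3) (k : ℂ) :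
    IsClosed (gradGraph O k : Set (PiLp 2 fun _ : Option (Fin 3) => L2 O)) := by
  have : (gradGraph O k : Set (PiLp 2 fun _ : Option (Fin 3) => L2 O))
      = ⋂ (i : Fin 3) (φ : E3 → ℝ) (hφ : IsTest O φ),
        {z | inner ℂ ((memLp_ofReal (hφ.pderiv_continuous i) (hφ.pderiv_compact i)).toLp _ : L2 O)
            (z none) = -inner ℂ ((memLp_ofReal hφ.smooth.continuous hφ.compact).toLp _ : L2 O)
            (k • z (some i))} := by
    ext z
    simp only [Set.mem_iInter, Set.mem_ofPred_eq]
    refine forall_congr' fun i => forall₂_congr fun φ hφ => ?_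
    rw [inner_toLp_ofReal (hφ.pderiv_continuous i) (hφ.pderiv_compact i) (z none),
      inner_toLp_ofReal hφ.smooth.continuous hφ.compact (k • z (some i))]
  rw [this]
  exact isClosed_iInter fun i => isClosed_iInter fun φ => isClosed_iInter fun hφ =>
    isClosed_eq (by fun_prop) (by fun_prop)

/-- For `c > 0`, the operator `-Δ_N + c` is onto. -/
theorem exists_neumannGraph_resolvent (O : Set E3) {c : ℝ} (hc : 0 < c) (f : L2 O) :
    ∃ w : L2 O, (w, f - (c : ℂ) • w) ∈ neumannGraph O := by
  set k : ℂ := ((√c : ℝ) : ℂ) with hk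
  have hkk : k * k = c := by rw [hk, ← Complex.ofReal_mul, Real.mul_self_sqrt hc.le]
  have hc0 : (c : ℂ) ≠ 0 := Complex.ofReal_ne_zero.mpr hc.ne'
  have hk0 : k ≠ 0 := fun h => hc0 (by rw [← hkk, h, zero_mul])
  have : CompleteSpace (gradGraph O k) := (isClosed_gradGraph O k).completeSpace_coe
  -- The vector `(c⁻¹ f, 0)` is projected onto the graph of `k⁻¹ ∇` with `k² = c`. Orthogonality of
  -- the error to `(v, k⁻¹ ∇v)`, multiplied by `c`, is the weak form of `(A + c) w = f`.
  let z₀ : PiLp 2 fun _ : Option (Fin 3) => L2 O :=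
    WithLp.toLp 2 fun o => o.elim ((c : ℂ)⁻¹ • f) fun _ => 0
  set z := (gradGraph O k).starProjection z₀ with hz
  have hzm : z ∈ gradGraph O k := Submodule.starProjection_apply_mem _ _
  refine ⟨z none, fun i => k • z (some i), hzm, fun v q hq => ?_⟩
  let y : PiLp 2 fun _ : Option (Fin 3) => L2 O :=
    WithLp.toLp 2 fun o => o.elim v fun i => k⁻¹ • q i
  have hy : y ∈ gradGraph O k := by
    change IsWeakGrad O v fun i => k • k⁻¹ • q i
    simpa [smul_smul, hk0] using hq
  have h1 : inner ℂ y (z₀ - z) = 0 :=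
    (Submodule.mem_orthogonal _ _).mp (Submodule.sub_starProjection_mem_orthogonal z₀) y hy
  rw [PiLp.inner_apply, Fintype.sum_option] at h1
  simp only [PiLp.sub_apply, y, z₀, Option.elim, zero_sub, inner_neg_right, inner_sub_right,
    inner_smul_left, inner_smul_right, Finset.sum_neg_distrib] at h1
  have hkc : (starRingEnd ℂ) k⁻¹ = k⁻¹ := by rw [hk, ← Complex.ofReal_inv, Complex.conj_ofReal]
  rw [hkc, ← Finset.mul_sum] at h1
  simp only [inner_sub_right, inner_smul_right]
  rw [← Finset.mul_sum, ← hkk]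
  rw [← hkk] at h1
  field_simp at h1
  linear_combination -h1

theorem mem_neumannGraph_iff (hO : IsOpen O) {u f : L2 O} : (u, f) ∈ neumannGraph O ↔
    ∃ h : u ∈ (negLaplacian O).domain, negLaplacian O ⟨u, h⟩ = f := by
  rw [← negLaplacian_graph hO, LinearPMap.mem_graph_iff]
  constructor
  · rintro ⟨⟨y, hy⟩, rfl, h⟩
    exact ⟨hy, h⟩
  · rintro ⟨h, h'⟩
    exact ⟨⟨u, h⟩, rfl, h'⟩

theorem negLaplacian_mem_neumannGraph (hO : IsOpen O) (u : (negLaplacian O).domain) :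
    ((u : L2 O), negLaplacian O u) ∈ neumannGraph O :=
  (mem_neumannGraph_iff hO).mpr ⟨u.2, rfl⟩

theorem negLaplacian_symm (hO : IsOpen O) (u v : (negLaplacian O).domain) :
    inner ℂ (negLaplacian O u) (v : L2 O) = inner ℂ (u : L2 O) (negLaplacian O v) := by
  obtain ⟨p, hp, hp'⟩ := negLaplacian_mem_neumannGraph hO u
  obtain ⟨q, hq, hq'⟩ := negLaplacian_mem_neumannGraph hO v
  dsimp only at hp hp' hq hq'
  rw [← hq' _ _ hp, ← inner_conj_symm, ← hp' _ _ hq, map_sum]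
  simp only [inner_conj_symm]

theorem eq_of_neumannGraph_resolvent (hO : IsOpen O) {c : ℝ} (hc : 0 < c) {f w w' : L2 O}
    (hw : (w, f - (c : ℂ) • w) ∈ neumannGraph O) (hw' : (w', f - (c : ℂ) • w') ∈ neumannGraph O) :
    w = w' := by
  obtain ⟨h1, e1⟩ := (mem_neumannGraph_iff hO).mp hw
  obtain ⟨h2, e2⟩ := (mem_neumannGraph_iff hO).mp hw'
  have hker := LinearMap.ker_eq_bot'.mp (negLaplacian_add_ker hO hc)
    ⟨w - w', Submodule.sub_mem _ h1 h2, trivial⟩ (by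
      change negLaplacian O (⟨w, h1⟩ - ⟨w', h2⟩) + (c : ℂ) • (w - w') = 0
      rw [LinearPMap.map_sub, e1, e2, smul_sub]
      abel)
  exact sub_eq_zero.mp (congrArg Subtype.val hker)

/-- The resolvent `(-Δ_N + c)⁻¹`, for `c > 0`. -/
noncomputable def neumannResolvent (hO : IsOpen O) {c : ℝ} (hc : 0 < c) : L2 O →ₗ[ℂ] L2 O where
  toFun f := (exists_neumannGraph_resolvent O hc f).choose
  map_add' f g := by
    refine eq_of_neumannGraph_resolvent hO hc
      (exists_neumannGraph_resolvent O hc (f + g)).choose_spec ?_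
    convert (neumannGraph O).add_mem (exists_neumannGraph_resolvent O hc f).choose_spec
      (exists_neumannGraph_resolvent O hc g).choose_spec using 1
    refine Prod.ext rfl ?_
    simp only [Prod.snd_add, smul_add]
    abel
  map_smul' a f := by
    refine eq_of_neumannGraph_resolvent hO hc
      (exists_neumannGraph_resolvent O hc (a • f)).choose_spec ?_
    convert (neumannGraph O).smul_mem a (exists_neumannGraph_resolvent O hc f).choose_spec using 1
    refine Prod.ext rfl ?_
    simp only [Prod.smul_snd, smul_sub, RingHom.id_apply, smul_comm (c : ℂ) a]

theorem neumannResolvent_spec (hO : IsOpen O) {c : ℝ} (hc : 0 < c) (f : L2 O) :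
    (neumannResolvent hO hc f, f - (c : ℂ) • neumannResolvent hO hc f) ∈ neumannGraph O :=
  (exists_neumannGraph_resolvent O hc f).choose_spec

end Neumann

/-! ### The function `θ` as a localizer -/

section Localization

/-- A bounded smooth function `θ` on the bounded open set `O` whose partial derivatives `χ i` are
test functions, with bounds on the first two derivatives. -/
structure Localizer (O : Set E3) (θ : E3 → ℝ) (χ : Fin 3 → E3 → ℝ) (D t : ℝ) : Prop where
  isOpen : IsOpen O
  bounded : Bornology.IsBounded O
  mult : IsMultiplier O θ
  smooth : ContDiffOn ℝ ∞ θ O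
  test : ∀ i, IsTest O (χ i)
  deriv : ∀ i, ∀ x ∈ O, pderiv i θ x = χ i x
  D_nonneg : 0 ≤ D
  t_pos : 0 < t
  bound : ∀ i, ∀ x ∈ O, |χ i x| ≤ D * t⁻¹
  bound' : ∀ i j, ∀ x ∈ O, |pderiv j (χ i) x| ≤ D * (t ^ 2)⁻¹

variable {O : Set E3} {θ : E3 → ℝ}

theorem SmoothUpToBoundary.isMultiplier (hO : IsOpen O) (hb : Bornology.IsBounded O)
    (h : SmoothUpToBoundary O θ) : IsMultiplier O θ := by
  obtain ⟨g, hg, hg'⟩ := h.2 0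
  obtain ⟨B, hB⟩ := hb.isCompact_closure.exists_bound_of_continuousOn hg
  refine .of_continuousOn hO h.1.continuousOn (B := B) fun x hx => ?_
  have h1 := hB x (subset_closure hx)
  rwa [hg' hx, norm_iteratedFDeriv_zero] at h1

theorem contDiffOn_pderiv (hO : IsOpen O) (h : ContDiffOn ℝ ∞ θ O) (i : Fin 3) :
    ContDiffOn ℝ ∞ (pderiv i θ) O :=
  (h.fderiv_of_isOpen hO (by simp)).clm_apply contDiffOn_const

/-- The closed support of `∇θ` lies in `O`, so the extension by zero vanishes near every point
outside `O` and is smooth there. That support is compact, being closed and bounded. -/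
theorem isTest_indicator_pderiv (hO : IsOpen O) (hb : Bornology.IsBounded O)
    (h : ContDiffOn ℝ ∞ θ O) (hs : GradSupportedIn O θ) (i : Fin 3) :
    IsTest O (O.indicator (pderiv i θ)) := by
  set S := closure {x | x ∈ O ∧ fderiv ℝ θ x ≠ 0} with hS
  have hsupp : Function.support (O.indicator (pderiv i θ)) ⊆ {x | x ∈ O ∧ fderiv ℝ θ x ≠ 0} := by
    intro x hx
    rw [Function.mem_support, Set.indicator_apply_ne_zero] at hx
    exact ⟨hx.1, fun h0 => hx.2 (by simp [pderiv, h0])⟩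
  have htsupp : tsupport (O.indicator (pderiv i θ)) ⊆ S := closure_mono hsupp
  refine ⟨contDiff_iff_contDiffAt.mpr fun x => ?_, ?_, htsupp.trans hs⟩
  · by_cases hx : x ∈ O
    · refine ((contDiffOn_pderiv hO h i).contDiffAt (hO.mem_nhds hx)).congr_of_eventuallyEq ?_
      filter_upwards [hO.mem_nhds hx] with y hy
      exact Set.indicator_of_mem hy _
    · exact contDiffAt_const.congr_of_eventuallyEq
        (notMem_tsupport_iff_eventuallyEq.mp fun h' => hx (hs (htsupp h')))
  · exact (Metric.isCompact_of_isClosed_isBounded isClosed_closure (hb.subset hs)).of_isClosed_subset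
      (isClosed_tsupport _) htsupp

theorem Localizer.of_derivBounds {C t : ℝ} (hO : IsOpen O) (hb : Bornology.IsBounded O)
    (h : SmoothUpToBoundary O θ) (hs : GradSupportedIn O θ) (ht : 0 < t)
    (hd : DerivBounds O θ C t) :
    Localizer O θ (fun i => O.indicator (pderiv i θ)) |C| t where
  isOpen := hO
  bounded := hb
  mult := h.isMultiplier hO hb
  smooth := h.1
  test := isTest_indicator_pderiv hO hb h.1 hs
  deriv i x hx := (Set.indicator_of_mem hx _).symm
  D_nonneg := abs_nonneg C
  t_pos := ht
  bound i x hx := by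
    rw [Set.indicator_of_mem hx]
    exact (hd x hx i i i).1.trans (by gcongr; exact le_abs_self C)
  bound' i j x hx := by
    have e : O.indicator (pderiv i θ) =ᶠ[nhds x] pderiv i θ := by
      filter_upwards [hO.mem_nhds hx] with y hy
      exact Set.indicator_of_mem hy _
    rw [pderiv, e.fderiv_eq]
    exact (hd x hx j i i).2.1.trans (by gcongr; exact le_abs_self C)

/-! ### Commutators of `θ` with the Neumann Laplacian -/

namespace Localizer

variable {χ : Fin 3 → E3 → ℝ} {D t : ℝ} (h : Localizer O θ χ D t)

/-- Multiplication by `θ`. -/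
noncomputable def mulθ : L2 O →L[ℂ] L2 O := mulCLM h.mult

/-- Multiplication by `∂ᵢ θ`. -/
noncomputable def mulχ (i : Fin 3) : L2 O →L[ℂ] L2 O := mulCLM (h.test i).isMultiplier

/-- Multiplication by `∂ⱼ ∂ᵢ θ`. -/
noncomputable def mulχ' (i j : Fin 3) : L2 O →L[ℂ] L2 O :=
  mulCLM ((h.test i).pderiv_isMultiplier j)

/-- Multiplication by `|∇θ|²`. -/
noncomputable def mulGradSq : L2 O →L[ℂ] L2 O := ∑ i, h.mulχ i ∘L h.mulχ i

/-- The commutator `2 ∇θ · ∇ + Δθ` of `θ` with `-Δ`, acting on `u` with weak gradient `p`. -/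
noncomputable def firstOrder (u : L2 O) (p : Fin 3 → L2 O) : L2 O :=
  ∑ i, ((2 : ℂ) • h.mulχ i (p i) + h.mulχ' i i u)

include h

theorem mulθ_weakGrad {u : L2 O} {p : Fin 3 → L2 O} (hu : IsWeakGrad O u p) :
    IsWeakGrad O (h.mulθ u) fun i => h.mulθ (p i) + h.mulχ i u :=
  hu.mulCLM h.isOpen h.smooth h.deriv h.mult fun i => (h.test i).isMultiplier

theorem mulχ_weakGrad (j : Fin 3) {u : L2 O} {p : Fin 3 → L2 O} (hu : IsWeakGrad O u p) :
    IsWeakGrad O (h.mulχ j u) fun i => h.mulχ j (p i) + h.mulχ' j i u :=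
  hu.mulCLM h.isOpen (h.test j).smooth.contDiffOn (fun _ _ _ => rfl) (h.test j).isMultiplier
    fun i => (h.test j).pderiv_isMultiplier i

theorem inner_mulχ_weakGrad (i : Fin 3) {u v : L2 O} {p q : Fin 3 → L2 O}
    (hu : IsWeakGrad O u p) (hv : IsWeakGrad O v q) :
    inner ℂ (q i) (h.mulχ i u) = -inner ℂ v (h.mulχ i (p i) + h.mulχ' i i u) :=
  (h.test i).inner_weakPartial h.isOpen h.bounded (hu i) (hv i)

theorem norm_mulχ_le (i : Fin 3) (u : L2 O) : ‖h.mulχ i u‖ ≤ D * t⁻¹ * ‖u‖ :=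
  norm_mulCLM_le _ h.isOpen (h.bound i) u

theorem norm_mulχ'_le (i j : Fin 3) (u : L2 O) : ‖h.mulχ' i j u‖ ≤ D * (t ^ 2)⁻¹ * ‖u‖ :=
  norm_mulCLM_le _ h.isOpen (h.bound' i j) u

theorem mulχ_mulθ (i : Fin 3) (u : L2 O) : h.mulχ i (h.mulθ u) = h.mulθ (h.mulχ i u) :=
  mulCLM_comm _ _ _

theorem mulχ'_mulθ (i j : Fin 3) (u : L2 O) : h.mulχ' i j (h.mulθ u) = h.mulθ (h.mulχ' i j u) :=
  mulCLM_comm _ _ _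

theorem mulχ'_mulχ (i j k : Fin 3) (u : L2 O) :
    h.mulχ' i j (h.mulχ k u) = h.mulχ k (h.mulχ' i j u) :=
  mulCLM_comm _ _ _

theorem inner_mulχ (i : Fin 3) (u v : L2 O) :
    inner ℂ (h.mulχ i u) v = inner ℂ u (h.mulχ i v) := inner_mulCLM _ u v

theorem inner_mulθ (u v : L2 O) : inner ℂ (h.mulθ u) v = inner ℂ u (h.mulθ v) :=
  inner_mulCLM _ u v

theorem mulGradSq_apply (u : L2 O) : h.mulGradSq u = ∑ i, h.mulχ i (h.mulχ i u) := by
  simp [mulGradSq]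

theorem inner_mulGradSq (u v : L2 O) :
    inner ℂ (h.mulGradSq u) v = inner ℂ u (h.mulGradSq v) := by
  rw [mulGradSq_apply, mulGradSq_apply, sum_inner, inner_sum]
  simp only [h.inner_mulχ]

theorem norm_mulGradSq_le (u : L2 O) : ‖h.mulGradSq u‖ ≤ 3 * D ^ 2 * (t ^ 2)⁻¹ * ‖u‖ := by
  rw [mulGradSq_apply]
  have hD := h.D_nonneg
  have ht := h.t_pos
  calc _ ≤ ∑ i : Fin 3, D * t⁻¹ * (D * t⁻¹ * ‖u‖) := by
        refine norm_sum_le_of_le _ fun i _ => (h.norm_mulχ_le i _).trans ?_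
        gcongr
        exact h.norm_mulχ_le i u
    _ = _ := by
      rw [Finset.sum_const, Finset.card_univ, Fintype.card_fin, ← inv_pow]
      ring

/-- Testing the equation for `u` with `θ v` gives the equation for `θ u` up to terms in `∇θ`. The
one containing `∇v` is integrated by parts against the compactly supported `∂ᵢθ`, so no boundary
term arises and `θ u` satisfies the Neumann condition again. -/
theorem mulθ_mem_neumannGraph {u f : L2 O} {p : Fin 3 → L2 O} (hu : IsWeakGrad O u p)
    (hf : ∀ (v : L2 O) (q : Fin 3 → L2 O), IsWeakGrad O v q →
      ∑ i, inner ℂ (q i) (p i) = inner ℂ v f) :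
    (h.mulθ u, h.mulθ f - h.firstOrder u p) ∈ neumannGraph O := by
  refine ⟨_, h.mulθ_weakGrad hu, fun v q hq => ?_⟩
  have h1 := hf _ _ (h.mulθ_weakGrad hq)
  simp only [inner_add_right, inner_add_left, inner_sub_right, h.inner_mulθ, h.inner_mulχ,
    firstOrder, inner_sum, inner_smul_right, Finset.sum_add_distrib, h.inner_mulχ_weakGrad _ hu hq,
    Finset.sum_neg_distrib, ← Finset.mul_sum] at h1 ⊢
  linear_combination h1

/-- The commutator of `2 ∇θ · ∇ + Δθ` with `θ` is `2 |∇θ|²`; this is the source of `[[A, T], T] = -2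
G`. -/
theorem firstOrder_mulθ (u : L2 O) (p : Fin 3 → L2 O) :
    h.firstOrder (h.mulθ u) (fun i => h.mulθ (p i) + h.mulχ i u)
      = h.mulθ (h.firstOrder u p) + (2 : ℂ) • h.mulGradSq u := by
  simp only [firstOrder, mulGradSq_apply, map_sum, Finset.smul_sum, ← Finset.sum_add_distrib]
  refine Finset.sum_congr rfl fun i _ => ?_
  rw [map_add, map_add, map_smul, h.mulχ_mulθ, h.mulχ'_mulθ, smul_add]
  abel

theorem norm_firstOrder_sq_le (u : L2 O) (p : Fin 3 → L2 O) :
    ‖h.firstOrder u p‖ ^ 2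
      ≤ 24 * D ^ 2 * (t ^ 2)⁻¹ * ∑ i, ‖p i‖ ^ 2 + 24 * D ^ 2 * (t ^ 4)⁻¹ * ‖u‖ ^ 2 := by
  have hD := h.D_nonneg
  have ht := h.t_pos
  have h1 : ‖h.firstOrder u p‖ ≤ ∑ i, (2 * (D * t⁻¹ * ‖p i‖) + D * (t ^ 2)⁻¹ * ‖u‖) := by
    refine norm_sum_le_of_le _ fun i _ => (norm_add_le _ _).trans (add_le_add ?_ ?_)
    · rw [norm_smul]
      have : ‖(2 : ℂ)‖ = 2 := by simp
      rw [this]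
      exact mul_le_mul_of_nonneg_left (h.norm_mulχ_le i _) (by norm_num)
    · exact h.norm_mulχ'_le i i u
  refine (pow_le_pow_left₀ (norm_nonneg _) h1 2).trans ?_
  have e2 : (t ^ 2)⁻¹ = t⁻¹ ^ 2 := (inv_pow _ _).symm
  have e4 : (t ^ 4)⁻¹ = t⁻¹ ^ 4 := (inv_pow _ _).symm
  rw [e2, e4]
  simp only [Fin.sum_univ_three]
  generalize t⁻¹ = τ
  generalize ‖p 0‖ = a
  generalize ‖p 1‖ = b
  generalize ‖p 2‖ = c
  generalize ‖u‖ = d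
  -- The constant is 24 = 2 · 4 · 3: the square of the sum of two terms costs 2, and `(a + b + c)² ≤
  -- 3 (a² + b² + c²)`. The other term needs only 2 · 9 = 18.
  have key : (2 * (a + b + c) + 3 * (τ * d)) ^ 2 ≤ 24 * (a ^ 2 + b ^ 2 + c ^ 2)
      + 24 * (τ * d) ^ 2 := by
    nlinarith [sq_nonneg (a - b), sq_nonneg (a - c), sq_nonneg (b - c),
      sq_nonneg (2 * (a + b + c) - 3 * (τ * d)), sq_nonneg (τ * d)]
  calc _ = (D * τ) ^ 2 * (2 * (a + b + c) + 3 * (τ * d)) ^ 2 := by ring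
    _ ≤ (D * τ) ^ 2 * (24 * (a ^ 2 + b ^ 2 + c ^ 2) + 24 * (τ * d) ^ 2) := by gcongr
    _ = _ := by ring

/-- `(∂ᵢθ)² u` lies in `H¹(O)`, so it may be used as a test function in the equation for `u`. The
resulting `⟨∇((∂ᵢθ)² u), ∇u⟩` involves at most second derivatives of `θ`. -/
theorem re_inner_mulGradSq_le {u f : L2 O} {p : Fin 3 → L2 O} (hu : IsWeakGrad O u p)
    (hf : ∀ (v : L2 O) (q : Fin 3 → L2 O), IsWeakGrad O v q →
      ∑ i, inner ℂ (q i) (p i) = inner ℂ v f) :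
    (inner ℂ f (h.mulGradSq u)).re
      ≤ 24 * D ^ 2 * (t ^ 2)⁻¹ * ∑ i, ‖p i‖ ^ 2 + 24 * D ^ 2 * (t ^ 4)⁻¹ * ‖u‖ ^ 2 := by
  have hD := h.D_nonneg
  have ht := h.t_pos
  have h1 : ∀ i, (inner ℂ f (h.mulχ i (h.mulχ i u))).re
      ≤ ∑ j, ((D * t⁻¹) ^ 2 * ‖p j‖ ^ 2
        + 2 * (D * t⁻¹ * (D * (t ^ 2)⁻¹)) * (‖u‖ * ‖p j‖)) := fun i => by
    have e := hf _ _ (h.mulχ_weakGrad i (h.mulχ_weakGrad i hu))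
    have e' : (inner ℂ f (h.mulχ i (h.mulχ i u))).re
        = (inner ℂ (h.mulχ i (h.mulχ i u)) f).re := inner_re_symm (𝕜 := ℂ) _ _
    rw [e', ← e, Complex.re_sum]
    refine Finset.sum_le_sum fun j _ => (re_inner_le_norm (𝕜 := ℂ) _ _).trans ?_
    have b1 : ‖h.mulχ i (h.mulχ i (p j) + h.mulχ' i j u) + h.mulχ' i j (h.mulχ i u)‖
        ≤ D * t⁻¹ * (D * t⁻¹ * ‖p j‖ + D * (t ^ 2)⁻¹ * ‖u‖)
          + D * t⁻¹ * (D * (t ^ 2)⁻¹ * ‖u‖) := by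
      rw [h.mulχ'_mulχ]
      refine (norm_add_le _ _).trans (add_le_add ((h.norm_mulχ_le i _).trans ?_)
        ((h.norm_mulχ_le i _).trans ?_))
      · gcongr
        exact (norm_add_le _ _).trans (add_le_add (h.norm_mulχ_le i _) (h.norm_mulχ'_le i j _))
      · gcongr
        exact h.norm_mulχ'_le i j _
    refine (mul_le_mul_of_nonneg_right b1 (norm_nonneg _)).trans (le_of_eq ?_)
    ring
  rw [mulGradSq_apply, inner_sum, Complex.re_sum]
  refine (Finset.sum_le_sum fun i _ => h1 i).trans ?_
  have e2 : (t ^ 2)⁻¹ = t⁻¹ ^ 2 := (inv_pow _ _).symm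
  have e4 : (t ^ 4)⁻¹ = t⁻¹ ^ 4 := (inv_pow _ _).symm
  rw [e2, e4]
  simp only [Fin.sum_univ_three]
  generalize t⁻¹ = τ
  generalize ‖p 0‖ = a
  generalize ‖p 1‖ = b
  generalize ‖p 2‖ = c
  generalize ‖u‖ = d
  have key : 3 * (a ^ 2 + b ^ 2 + c ^ 2) + 6 * (τ * d) * (a + b + c)
      ≤ 24 * (a ^ 2 + b ^ 2 + c ^ 2) + 24 * (τ * d) ^ 2 := by
    nlinarith [sq_nonneg (τ * d - a), sq_nonneg (τ * d - b), sq_nonneg (τ * d - c),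
      sq_nonneg a, sq_nonneg b, sq_nonneg c, sq_nonneg (τ * d)]
  calc _ = (D * τ) ^ 2 * (3 * (a ^ 2 + b ^ 2 + c ^ 2) + 6 * (τ * d) * (a + b + c)) := by ring
    _ ≤ (D * τ) ^ 2 * (24 * (a ^ 2 + b ^ 2 + c ^ 2) + 24 * (τ * d) ^ 2) := by gcongr
    _ = _ := by ring

theorem exists_weakGrad (x : (negLaplacian O).domain) : ∃ p, IsWeakGrad O (x : L2 O) p ∧
    (∀ (v : L2 O) (q : Fin 3 → L2 O), IsWeakGrad O v q →
      ∑ i, inner ℂ (q i) (p i) = inner ℂ v (negLaplacian O x)) ∧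
    (inner ℂ (x : L2 O) (negLaplacian O x)).re = ∑ i, ‖p i‖ ^ 2 ∧
    ∃ hm : h.mulθ x ∈ (negLaplacian O).domain,
      negLaplacian O ⟨h.mulθ x, hm⟩ = h.mulθ (negLaplacian O x) - h.firstOrder x p := by
  obtain ⟨p, hp, hp'⟩ := negLaplacian_mem_neumannGraph h.isOpen x
  refine ⟨p, hp, hp', ?_, (mem_neumannGraph_iff h.isOpen).mp (h.mulθ_mem_neumannGraph hp hp')⟩
  rw [← hp' _ _ hp, Complex.re_sum]
  exact Finset.sum_congr rfl fun i _ => inner_self_eq_norm_sq (𝕜 := ℂ) _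

theorem mulθ_mem (x : (negLaplacian O).domain) : h.mulθ x ∈ (negLaplacian O).domain :=
  let ⟨_, _, _, _, hm, _⟩ := h.exists_weakGrad x
  hm

theorem double_comm_mulθ (x : (negLaplacian O).domain) :
    negLaplacian O ⟨h.mulθ (h.mulθ x), h.mulθ_mem ⟨_, h.mulθ_mem x⟩⟩
      - (2 : ℂ) • h.mulθ (negLaplacian O ⟨h.mulθ x, h.mulθ_mem x⟩)
      + h.mulθ (h.mulθ (negLaplacian O x)) = -(2 : ℂ) • h.mulGradSq x := by
  obtain ⟨p, hp, hp', -, hm, e1⟩ := h.exists_weakGrad x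
  obtain ⟨q, hq, hq', -, hm', e2⟩ := h.exists_weakGrad ⟨h.mulθ x, hm⟩
  -- The weak gradient `q` of `θ x` comes from an existence statement; uniqueness of weak gradients
  -- identifies it with the Leibniz formula.
  have hqp : q = fun i => h.mulθ (p i) + h.mulχ i x := by
    funext i
    refine sub_eq_zero.mp (eq_zero_of_test h.isOpen _ fun φ hφ => ?_)
    have h1 := hq i φ hφ
    rw [h.mulθ_weakGrad hp i φ hφ] at h1
    have h2 := integral_smul_add hφ.smooth.continuous hφ.compact (q i)
      ((-1 : ℂ) • (h.mulθ (p i) + h.mulχ i x))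
    rw [integral_smul_smul, neg_injective h1] at h2
    rw [sub_eq_add_neg, ← neg_one_smul ℂ, h2]
    ring
  subst hqp
  dsimp only at e2
  rw [e2, h.firstOrder_mulθ, e1, map_sub]
  module

theorem commutatorData {c : ℝ} (hc : 0 < c) :
    CommutatorData (negLaplacian O) (neumannResolvent h.isOpen hc)
      (h.mulθ : L2 O →ₗ[ℂ] L2 O) (h.mulGradSq : L2 O →ₗ[ℂ] L2 O) c
      (24 * D ^ 2 * (t ^ 2)⁻¹) (24 * D ^ 2 * (t ^ 4)⁻¹) where
  c_pos := hc
  α_nonneg := by have := h.t_pos; positivity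
  β_nonneg := by have := h.t_pos; positivity
  symm := negLaplacian_symm h.isOpen
  nonneg x := by
    obtain ⟨p, -, -, e, -⟩ := h.exists_weakGrad x
    rw [e]
    positivity
  R_mem x := ((mem_neumannGraph_iff h.isOpen).mp (neumannResolvent_spec h.isOpen hc x)).1
  A_R x := ((mem_neumannGraph_iff h.isOpen).mp (neumannResolvent_spec h.isOpen hc x)).2
  R_A x := by
    refine eq_of_neumannGraph_resolvent h.isOpen hc (neumannResolvent_spec h.isOpen hc _) ?_
    rw [add_sub_cancel_right]
    exact negLaplacian_mem_neumannGraph h.isOpen x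
  T_symm := h.inner_mulθ
  T_mem := h.mulθ_mem
  G_symm := h.inner_mulGradSq
  G_le x := by
    refine (h.norm_mulGradSq_le x).trans ?_
    have := h.t_pos
    gcongr
    norm_num
  double_comm := h.double_comm_mulθ
  comm_le x := by
    obtain ⟨p, -, -, e, hm, e1⟩ := h.exists_weakGrad x
    rw [e]
    refine le_trans (le_of_eq ?_) (h.norm_firstOrder_sq_le x p)
    rw [← norm_neg (h.firstOrder x p)]
    congr 2
    exact sub_eq_iff_eq_add'.mpr (e1.trans (sub_eq_add_neg _ _))
  form_le x := by
    obtain ⟨p, hp, hp', e, -⟩ := h.exists_weakGrad x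
    rw [e]
    exact h.re_inner_mulGradSq_le hp hp'

end Localizer

end Localization

end DoubleCommutator

open DoubleCommutator
-- The theorem
theorem mainTheorem6 (C : ℝ) :
    ∃ C' : ℝ, 0 < C' ∧
      ∀ O : Set E3, IsOpen O → Bornology.IsBounded O →
      ∀ θ : E3 → ℝ, SmoothUpToBoundary O θ → GradSupportedIn O θ →
      ∀ t : ℝ, 0 < t → DerivBounds O θ C t →
      ∀ s : ℝ, 0 < s →
        ((opComm (opComm (opSqFrac (negLaplacian O) (s ^ 2)⁻¹) (mulOp O θ))
              (mulOp O θ)).domain = (negLaplacian O).domain ∧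
          OpLE
            ((-(C' * (t ^ 2)⁻¹ : ℝ) : ℂ) • opFrac (negLaplacian O) (s ^ 2)⁻¹
              - opScalar (C' * s ^ 2 * (t ^ 4)⁻¹))
            (opComm (opComm (opSqFrac (negLaplacian O) (s ^ 2)⁻¹) (mulOp O θ)) (mulOp O θ))) ∧
        ((opComm (opComm (opFrac (negLaplacian O) (s ^ 2)⁻¹) (mulOp O θ))
              (mulOp O θ)).domain = ⊤ ∧
          ∀ u : (opComm (opComm (opFrac (negLaplacian O) (s ^ 2)⁻¹) (mulOp O θ))
              (mulOp O θ)).domain,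
            ‖opComm (opComm (opFrac (negLaplacian O) (s ^ 2)⁻¹) (mulOp O θ)) (mulOp O θ) u‖
              ≤ C' * (s ^ 2 * (t ^ 2)⁻¹ + s ^ 4 * (t ^ 4)⁻¹) * ‖(u : L2 O)‖) := by
  -- 144 = 6 · 24 comes from the lower bound, with `α = 24 C² t⁻²` and `β = 24 C² t⁻⁴`; the norm
  -- bound needs only 4 · 24 = 96. The added 1 keeps the constant positive when `C = 0`.
  refine ⟨144 * |C| ^ 2 + 1, by positivity, fun O hO hb θ hθ hs t ht hd s hs0 => ?_⟩
  have hc : 0 < (s ^ 2)⁻¹ := by positivity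
  have hL := Localizer.of_derivBounds hO hb hθ hs ht hd
  have hA := hL.commutatorData hc
  have hmul : mulOp O θ = (hL.mulθ : L2 O →ₗ[ℂ] L2 O).toPMap ⊤ := mulOp_eq hL.mult
  rw [hmul]
  refine ⟨⟨hA.domain_double_opComm_opSqFrac, hA.opLE_double_opComm ?_ ?_⟩,
    hA.domain_double_opComm_opFrac, fun u => (hA.norm_double_opComm_opFrac_le u).trans ?_⟩
  · rw [← mul_assoc]
    gcongr
    linarith
  · rw [inv_inv]
    calc _ = 144 * |C| ^ 2 * s ^ 2 * (t ^ 4)⁻¹ := by ring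
      _ ≤ _ := by gcongr; linarith
  · gcongr ?_ * _
    rw [inv_inv]
    calc _ = 96 * |C| ^ 2 * (s ^ 2 * (t ^ 2)⁻¹ + s ^ 4 * (t ^ 4)⁻¹) := by ring
      _ ≤ _ := by gcongr; nlinarith [sq_nonneg |C|]
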